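/- Let $n\ge m\ge 5$, let $1\le k\le m$, and let $X$ be a Hermitian operator on $\mathbb C^m\otimes\mathbb C^n$ with operator Schmidt coefficients $\mu_1\ge\mu_2\ge\dots\ge\mu_{m^2}\ge 0$, that is, $X=\sum_{i=1}^{m^2}\mu_i\,A_i\otimes B_i$, where $(A_i)_{i\le m^2}$ and $(B_i)_{i\le n^2}$ are orthonormal bases of the $m\times m$ and $n\times n$ complex matrices for the Hilbert–Schmidt inner product $\langle A,B\rangle=\operatorname{Tr}(A^\dagger B)$. For a state $\rho$ (positive semidefinite, trace one) the Schmidt number $SN(\rho)$ is the minimum, over all representations of $\rho$ as a convex combination of pure states, of the largest Schmidt rank that occurs; let $S_k$ be the set of states $\rho$ with $SN(\rho)\le k$. Let $$\lambda_{k+1}=\max\{\langle\Psi|X|\Psi\rangle:\ \|\Psi\|=1,\ \Psi\text{ of Schmidt rank at most }k\}.$$ Put $$P=\mu_1+\sum_{j=2}^{k}\mu_{2j-2}=\mu_1+\mu_2+\mu_4+\dots+\mu_{2k-2},\qquad p=\sum_{i=1}^{k}\mu_{k^2-(k-i)^2}=\mu_{2k-1}+\mu_{4k-4}+\dots+\mu_{k^2-1}+\mu_{k^2},$$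 $$\eta_{k+1}=P-\mu_{k^2}\left(1-\sqrt{\frac pP}\right)$$ (with $\eta_{k+1}=0$ if $P=0$). Then the maximum defining $\lambda_{k+1}$ is attained, and $$\lambda_{k+1}\le\eta_{k+1}.$$ Consequently $\eta_{k+1}\mathbb I-X$ is a $(k+1)$-Schmidt number witness: it is Hermitian and $\operatorname{Tr}\big((\eta_{k+1}\mathbb I-X)\sigma\big)\ge 0$ for all $\sigma\in S_k$, so that every state $\rho$ with $\operatorname{Tr}\big((\eta_{k+1}\mathbb I-X)\rho\big)<0$ has Schmidt number at least $k+1$. There exists $\rho\in S_{k+1}$ with $\operatorname{Tr}\big((\eta_{k+1}\mathbb I-X)\rho\big)<0$ if and only if $\eta_{k+1}<\lambda_{k+2}$, where $\lambda_{k+2}$ is the maximum of $\langle\Psi|X|\Psi\rangle$ over unit vectors of Schmidt rank at most $k+1$. -/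

import Mathlib

open scoped Kronecker ComplexOrder

noncomputable section

/-- Orthonormality of a family of `N` complex `d × d` matrices for the Hilbert–Schmidt inner
product `⟨A, B⟩ = Tr (A† B)`.  When `N = d ^ 2` such a family is an orthonormal basis. -/
def HSOrthonormal {d N : ℕ} (A : Fin N → Matrix (Fin d) (Fin d) ℂ) : Prop :=
  ∀ i j, ((A i).conjTranspose * A j).trace = if i = j then 1 else 0

/-- `μ 1 ≥ μ 2 ≥ ⋯ ≥ 0`, with indices up to `min (m ^ 2) (n ^ 2)`, are the operator Schmidt
coefficients of `X`, padded by zeros: `X = ∑ i, μ i • A i ⊗ B i` for some Hilbert–Schmidt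
orthonormal bases `A`, `B` of the two local operator spaces (0-based here, while `μ` is 1-based).
Values of `μ` at other indices are irrelevant. -/
def IsOperatorSchmidtCoeffs {m n : ℕ} (X : Matrix (Fin m × Fin n) (Fin m × Fin n) ℂ)
    (μ : ℕ → ℝ) : Prop :=
  AntitoneOn μ (Set.Icc 1 (min (m ^ 2) (n ^ 2))) ∧
  (∀ i ∈ Set.Icc 1 (min (m ^ 2) (n ^ 2)), 0 ≤ μ i) ∧
  ∃ (A : Fin (m ^ 2) → Matrix (Fin m) (Fin m) ℂ) (B : Fin (n ^ 2) → Matrix (Fin n) (Fin n) ℂ),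
    HSOrthonormal A ∧ HSOrthonormal B ∧
    X = ∑ i : Fin (min (m ^ 2) (n ^ 2)), ((μ (i + 1) : ℝ) : ℂ) •
      (A (Fin.castLE (min_le_left _ _) i) ⊗ₖ B (Fin.castLE (min_le_right _ _) i))

/-- `Ψ = ∑ l, s l • u l ⊗ v l` is a Schmidt decomposition with exactly `r` nonzero coefficients. -/
def HasSchmidtDecomposition {m n : ℕ} (Ψ : EuclideanSpace ℂ (Fin m × Fin n)) (r : ℕ) : Prop :=
  ∃ (s : Fin r → ℝ) (u : Fin r → EuclideanSpace ℂ (Fin m)) (v : Fin r → EuclideanSpace ℂ (Fin n)),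
    (∀ l, 0 < s l) ∧ Orthonormal ℂ u ∧ Orthonormal ℂ v ∧
    ∀ i j, Ψ (i, j) = ∑ l, (s l : ℂ) * u l i * v l j

/-- The Schmidt rank: the number of nonzero Schmidt coefficients (every vector has a Schmidt
decomposition and all its Schmidt decompositions have the same length). -/
def schmidtRank {m n : ℕ} (Ψ : EuclideanSpace ℂ (Fin m × Fin n)) : ℕ :=
  sInf {r | HasSchmidtDecomposition Ψ r}

/-- The rank-one operator `|Ψ⟩⟨Ψ|`. -/
def ketBra {m n : ℕ} (Ψ : EuclideanSpace ℂ (Fin m × Fin n)) :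
    Matrix (Fin m × Fin n) (Fin m × Fin n) ℂ :=
  Matrix.of fun a b => Ψ a * star (Ψ b)

/-- Bipartite mixed states. -/
def IsDensityMatrix {m n : ℕ} (ρ : Matrix (Fin m × Fin n) (Fin m × Fin n) ℂ) : Prop :=
  ρ.PosSemidef ∧ ρ.trace = 1

/-- The Schmidt number of a state: the minimum, over all decompositions of `ρ` as a convex
combination of pure states, of the largest Schmidt rank that occurs. -/
def schmidtNumber {m n : ℕ} (ρ : Matrix (Fin m × Fin n) (Fin m × Fin n) ℂ) : ℕ :=
  sInf {r | ∃ (N : ℕ) (p : Fin N → ℝ) (Ψ : Fin N → EuclideanSpace ℂ (Fin m × Fin n)),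
    (∀ i, 0 ≤ p i) ∧ ∑ i, p i = 1 ∧ (∀ i, ‖Ψ i‖ = 1) ∧
    ρ = ∑ i, (p i : ℂ) • ketBra (Ψ i) ∧ ∀ i, schmidtRank (Ψ i) ≤ r}

/-- The (convex) set `S_k` of states with Schmidt number at most `k`. -/
def schmidtSet (m n k : ℕ) : Set (Matrix (Fin m × Fin n) (Fin m × Fin n) ℂ) :=
  {ρ | IsDensityMatrix ρ ∧ schmidtNumber ρ ≤ k}

/-- For `k ≥ 1`: a `k`-Schmidt number witness, a Hermitian observable whose expectation value is
nonnegative on every state with Schmidt number at most `k - 1`. -/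
def IsSchmidtNumberWitness {m n : ℕ} (k : ℕ)
    (W : Matrix (Fin m × Fin n) (Fin m × Fin n) ℂ) : Prop :=
  W.IsHermitian ∧ ∀ σ ∈ schmidtSet m n (k - 1), 0 ≤ (W * σ).trace.re

/-- For `k ≥ 1`: a `k`-Schmidt number witness that moreover detects at least one state of `S_k`. -/
def IsDetectingSchmidtNumberWitness {m n : ℕ} (k : ℕ)
    (W : Matrix (Fin m × Fin n) (Fin m × Fin n) ℂ) : Prop :=
  IsSchmidtNumberWitness k W ∧ ∃ ρ ∈ schmidtSet m n k, (W * ρ).trace.re < 0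

/-- The (real) expectation value `⟨Ψ|X|Ψ⟩`. -/
def expectation {m n : ℕ} (X : Matrix (Fin m × Fin n) (Fin m × Fin n) ℂ)
    (Ψ : EuclideanSpace ℂ (Fin m × Fin n)) : ℝ :=
  (∑ a, ∑ b, star (Ψ a) * X a b * Ψ b).re

/-- The expectation values of `X` in the pure states of Schmidt rank at most `k`. -/
def expectationSet {m n : ℕ} (X : Matrix (Fin m × Fin n) (Fin m × Fin n) ℂ) (k : ℕ) : Set ℝ :=
  {t | ∃ Ψ : EuclideanSpace ℂ (Fin m × Fin n),
    ‖Ψ‖ = 1 ∧ schmidtRank Ψ ≤ k ∧ t = expectation X Ψ}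

/-- `optimalCoeff X k` is the optimal `k`-Schmidt witness coefficient `λ_k`, for `k ≥ 2`: the
largest expectation value of `X` in a pure state of Schmidt rank at most `k - 1`. -/
def optimalCoeff {m n : ℕ} (X : Matrix (Fin m × Fin n) (Fin m × Fin n) ℂ) (k : ℕ) : ℝ :=
  sSup (expectationSet X (k - 1))

/-- `P = μ 1 + μ 2 + μ 4 + ⋯ + μ (2k-2)`, the first row sum of the coefficient matrix. -/
def firstRowSum (μ : ℕ → ℝ) (k : ℕ) : ℝ :=
  μ 1 + ∑ j ∈ Finset.Icc 2 k, μ (2 * j - 2)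

/-- `p = μ (2k-1) + μ (4k-4) + ⋯ + μ (k²-1) + μ (k²)`, the last row sum of the coefficient
matrix; the `i`-th index is `k² - (k-i)²`. -/
def lastRowSum (μ : ℕ → ℝ) (k : ℕ) : ℝ :=
  ∑ i ∈ Finset.Icc 1 k, μ (k ^ 2 - (k - i) ^ 2)

/-- The Ledermann-type bound `η_{k+1} = P - μ (k²) (1 - √(p / P))`, as a function of `k`.
If `P = 0` then `μ (k²) = 0` and the bound is `0`. -/
def etaBound (μ : ℕ → ℝ) (k : ℕ) : ℝ :=
  firstRowSum μ k - μ (k ^ 2) * (1 - √(lastRowSum μ k / firstRowSum μ k))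

end

/-! Write a unit vector of Schmidt rank at most k as a k-term sum of `s l • u l ⊗ v l`. Its
expectation is at most a sum over pairs p = (l, l') of `c p * (s l * s l')`, where c p is a
combination of the coefficients μ with weights given by products of moduli of matrix elements of the
two local bases. Bessel's inequality, applied both to the dyads |u l⟩⟨u l'| and to the operator
bases, makes these weights doubly substochastic. Hence c is weakly majorized by μ, and sorting the
pairs by product bounds the expectation by the quadratic form of a k × k matrix whose entries are μ
1, …, μ (k²) in some arrangement (`exists_expectation_le_arrangementForm`).

It remains to bound all such forms. A maximizer over arrangements and unit vectors may be taken with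
x nonnegative and decreasing and with the entries ordered like the products x i * x j
(`exists_sorted_maximal_arrangement`). Counting the entries that must precede a given one bounds the
first and last rows. The vector x is an eigenvector of the symmetrized matrix
(`eigenvector_of_maximal`); comparing its first and last coordinates, in the manner of Ledermann,
gives a quadratic inequality for the eigenvalue, and `ledermann_algebra` turns it into the bound by
η.

Schmidt rank is the rank of the coefficient matrix, so bounded rank is a closed condition and the
maximum is attained by compactness. The witness statements follow because the trace against a
mixture is the average over its pure states. -/

/-! ### Rearrangement and majorization inequalities -/

theorem sum_filter_val_lt {N t : ℕ} (ht : t ≤ N) (f : ℕ → ℝ) :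
    ∑ i : Fin N with i.val < t, f i = ∑ i ∈ Finset.range t, f i := by
  refine Finset.sum_bij (fun i _ => i.val) ?_ ?_ ?_ ?_
  · intro i hi; simpa using hi
  · intro i _ j _ hij; exact Fin.ext hij
  · intro b hb
    have hb' := Finset.mem_range.1 hb
    exact ⟨⟨b, by omega⟩, by simpa using hb', rfl⟩
  · intro i _; rfl

/-- A nonnegative antitone weight preserves nonnegativity of partial sums. -/
theorem sum_range_mul_ge_of_antitone {σ D : ℕ → ℝ} (N : ℕ)
    (hσ : ∀ i j, i ≤ j → j ≤ N → σ j ≤ σ i)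
    (hD : ∀ t ≤ N + 1, 0 ≤ ∑ i ∈ Finset.range t, D i) :
    σ N * ∑ i ∈ Finset.range (N + 1), D i ≤ ∑ i ∈ Finset.range (N + 1), σ i * D i := by
  induction N with
  | zero => simp
  | succ N ih =>
    have h := ih (fun i j hij hj => hσ i j hij (by omega)) (fun t ht => hD t (by omega))
    rw [Finset.sum_range_succ _ (N + 1), Finset.sum_range_succ _ (N + 1), mul_add]
    have h1 := hσ N (N + 1) (by omega) le_rfl
    have h2 := hD (N + 1) (by omega)
    nlinarith

/-- Abel summation comparison. -/
theorem sum_mul_le_sum_mul_of_partial_sums {N : ℕ} {σ c d : Fin N → ℝ} (hσ : Antitone σ)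
    (hσ0 : ∀ i, 0 ≤ σ i)
    (h : ∀ t ≤ N, ∑ i with i.val < t, c i ≤ ∑ i with i.val < t, d i) :
    ∑ i, σ i * c i ≤ ∑ i, σ i * d i := by
  rcases N with _ | N
  · simp
  let σ' : ℕ → ℝ := fun i => if h : i < N + 1 then σ ⟨i, h⟩ else 0
  let D : ℕ → ℝ := fun i => if h : i < N + 1 then d ⟨i, h⟩ - c ⟨i, h⟩ else 0
  have hpart : ∀ t ≤ N + 1, ∑ i ∈ Finset.range t, D i
      = ∑ i : Fin (N + 1) with i.val < t, (d i - c i) := by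
    intro t ht
    rw [← sum_filter_val_lt ht]
    refine Finset.sum_congr rfl fun i _ => ?_
    simp only [D, i.isLt, dif_pos, Fin.eta]
  have key := sum_range_mul_ge_of_antitone (σ := σ') (D := D) N
    (by
      intro i j hij hj
      have h1 : i < N + 1 := by omega
      have h2 : j < N + 1 := by omega
      simp only [σ', h1, h2, dif_pos]
      exact hσ hij)
    (by
      intro t ht
      rw [hpart t ht, Finset.sum_sub_distrib]
      linarith [h t ht])
  have h0 : 0 ≤ σ' N * ∑ i ∈ Finset.range (N + 1), D i := by
    refine mul_nonneg ?_ ?_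
    · simp only [σ', Nat.lt_succ_self, dif_pos]; exact hσ0 _
    · rw [hpart _ le_rfl, Finset.sum_sub_distrib]
      linarith [h _ le_rfl]
  have hs : ∑ i ∈ Finset.range (N + 1), σ' i * D i = ∑ i, (σ i * d i - σ i * c i) := by
    rw [Finset.sum_range]
    refine Finset.sum_congr rfl fun i _ => ?_
    simp only [σ', D, i.isLt, dif_pos, Fin.eta]
    ring
  rw [hs, Finset.sum_sub_distrib] at key
  linarith

/-- Bathtub principle: weights in `[0, 1]` of total mass at most `t` pick up at most the `t`
largest values. -/
theorem sum_mul_le_sum_first {μ : ℕ → ℝ} {N t : ℕ} (ht : t ≤ N)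
    (hanti : AntitoneOn μ (Set.Icc 1 N)) (hpos : ∀ i ∈ Set.Icc 1 N, 0 ≤ μ i)
    {W : Fin N → ℝ} (h0 : ∀ i, 0 ≤ W i) (h1 : ∀ i, W i ≤ 1) (hs : ∑ i, W i ≤ t) :
    ∑ i : Fin N, μ (i + 1) * W i ≤ ∑ i ∈ Finset.range t, μ (i + 1) := by
  rcases Nat.eq_zero_or_pos t with rfl | htp
  · have hz : ∀ i, W i = 0 := by
      have := (Finset.sum_eq_zero_iff_of_nonneg (fun i _ => h0 i)).1
        (le_antisymm (by simpa using hs) (Finset.sum_nonneg fun i _ => h0 i))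
      exact fun i => this i (Finset.mem_univ i)
    simp [hz]
  have hmt : 0 ≤ μ t := hpos t ⟨htp, ht⟩
  -- Threshold at μ t: a weight at most 1 collects at most the excess over μ t on the first t
  -- indices, and elsewhere no value exceeds μ t.
  have hle : ∀ i : Fin N, μ (i + 1) * W i
      ≤ (if i.val < t then μ (i + 1) - μ t else 0) + μ t * W i := by
    intro i
    have hi := i.isLt
    split_ifs with hit
    · have := hanti (a := i.val + 1) (b := t) ⟨by omega, by omega⟩ ⟨htp, ht⟩ (by omega)
      nlinarith [h1 i]
    · have := hanti (a := t) (b := i.val + 1) ⟨htp, ht⟩ ⟨by omega, by omega⟩ (by omega)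
      nlinarith [h0 i]
  refine (Finset.sum_le_sum fun i _ => hle i).trans ?_
  rw [Finset.sum_add_distrib, ← Finset.mul_sum, ← Finset.sum_filter]
  have hbij : ∑ i : Fin N with i.val < t, (μ (i + 1) - μ t)
      = ∑ i ∈ Finset.range t, (μ (i + 1) - μ t) :=
    sum_filter_val_lt ht fun i => μ (i + 1) - μ t
  rw [hbij, Finset.sum_sub_distrib]
  simp only [Finset.sum_const, Finset.card_range, nsmul_eq_mul]
  nlinarith

/-- A finite type can be enumerated compatibly with the strict order of a key. -/
theorem exists_equiv_fin_of_key {ι α : Type*} [Fintype ι] [LinearOrder α] {N : ℕ}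
    (hN : Fintype.card ι = N) (key : ι → α) :
    ∃ e : ι ≃ Fin N, ∀ p q, key p < key q → e p < e q := by
  let e0 : ι ≃ Fin N := Fintype.equivFinOfCardEq hN
  refine ⟨e0.trans (Tuple.sort (key ∘ e0.symm)).symm, fun p q hpq => ?_⟩
  by_contra hcon
  have := Tuple.monotone_sort (key ∘ e0.symm) (not_lt.1 hcon)
  simp at this
  exact absurd hpq (not_lt.2 this)

/-- A family whose subset sums are dominated by `μ` pairs with `y ≥ 0` at most as the decreasing
arrangement of `μ` does. -/
theorem sum_mul_le_of_subset_sums {ι : Type*} [Fintype ι] {N : ℕ} {μ : ℕ → ℝ} {y c : ι → ℝ}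
    (hy : ∀ p, 0 ≤ y p) (e : ι ≃ Fin N) (he : ∀ p q, y q < y p → e p < e q)
    (hc : ∀ S : Finset ι, ∑ p ∈ S, c p ≤ ∑ i ∈ Finset.range S.card, μ (i + 1)) :
    ∑ p, c p * y p ≤ ∑ p, μ (e p + 1) * y p := by
  have key := sum_mul_le_sum_mul_of_partial_sums (σ := fun i => y (e.symm i))
    (c := fun i => c (e.symm i)) (d := fun i => μ (i + 1))
    (by
      intro i j hij
      by_contra hcon
      have := he _ _ (not_le.1 hcon)
      simp at this
      exact absurd hij (not_le.2 this))
    (fun i => hy _)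
    (by
      intro t ht
      have h1 := hc ((Finset.univ.filter fun i : Fin N => i.val < t).map e.symm.toEmbedding)
      have hcard : (Finset.univ.filter fun i : Fin N => i.val < t).card = t := by
        rw [Fin.card_filter_val_lt]; omega
      rw [Finset.sum_map, Finset.card_map, hcard] at h1
      exact h1.trans (sum_filter_val_lt ht fun i => μ (i + 1)).ge)
  rw [← Equiv.sum_comp e.symm, ← Equiv.sum_comp e.symm (fun p => μ (e p + 1) * y p)]
  simpa [mul_comm] using key

theorem subset_sums_of_equiv {ι : Type*} [Fintype ι] {N : ℕ} {μ : ℕ → ℝ}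
    (hanti : AntitoneOn μ (Set.Icc 1 N)) (hpos : ∀ i ∈ Set.Icc 1 N, 0 ≤ μ i)
    (e : ι ≃ Fin N) (S : Finset ι) :
    ∑ p ∈ S, μ (e p + 1) ≤ ∑ i ∈ Finset.range S.card, μ (i + 1) := by
  classical
  have hcard : S.card ≤ N := by
    simpa [Fintype.card_congr e] using Finset.card_le_univ S
  have := sum_mul_le_sum_first hcard hanti hpos
    (W := fun i => if e.symm i ∈ S then 1 else 0)
    (fun i => by split_ifs <;> simp) (fun i => by split_ifs <;> simp)
    (by
      rw [← Equiv.sum_comp e]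
      simp)
  refine le_trans (le_of_eq ?_) this
  rw [← Equiv.sum_comp e]
  simp [Finset.sum_ite_mem]

/-- If everything in `S` precedes `p`, then `p` has position at least `S.card`. -/
theorem card_le_of_forall_lt {ι : Type*} {N : ℕ} (e : ι ≃ Fin N) (S : Finset ι) (p : ι)
    (h : ∀ q ∈ S, e q < e p) : S.card ≤ (e p).val := by
  have : S.map e.toEmbedding ⊆ Finset.Iio (e p) := by
    intro i hi
    obtain ⟨q, hq, rfl⟩ := Finset.mem_map.1 hi
    exact Finset.mem_Iio.2 (h q hq)
  simpa using Finset.card_le_card this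

/-! ### The scalar inequality -/

/-- The algebraic inequality behind the Ledermann-type bound. -/
theorem ledermann_algebra {P h κ t r : ℝ} (hκ : 0 ≤ κ) (hκh : κ ≤ h) (hP : 2 * h ≤ P)
    (ht0 : 0 ≤ t) (ht1 : t ≤ 1) (hκt : 2 * κ ≤ P * t ^ 2)
    (hr1 : r ≤ P * t ^ 2 - κ + (h - κ) / 2) (hr2 : r ≤ P - h) :
    h * r ≤ (h - κ * (1 - t)) * (P - 2 * κ + κ * t) := by
  obtain ⟨w, rfl⟩ : ∃ w, h = κ + w := ⟨h - κ, by ring⟩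
  obtain ⟨s, rfl⟩ : ∃ s, t = 1 - s := ⟨1 - t, by ring⟩
  have hw : 0 ≤ w := by linarith
  have hs : 0 ≤ s := by linarith
  have hs1 : s ≤ 1 := by linarith
  have hP0 : 0 ≤ P := by linarith
  -- Here w = h - κ and s = 1 - t. A large gap w makes the crude bound `hr2` sufficient; otherwise
  -- the telescoped bound `hr1` is the sharper one.
  rcases le_or_gt (s * P) w with hc | hc
  · have h1 : (κ + w) * r ≤ (κ + w) * (P - (κ + w)) := mul_le_mul_of_nonneg_left hr2 (by linarith)
    have h2 : κ * (s * P) ≤ κ * w := mul_le_mul_of_nonneg_left hc hκ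
    have h3 : 2 * κ * s ≤ s * P := by nlinarith
    have h4 : 2 * κ * s * w ≤ w * w := mul_le_mul_of_nonneg_right (h3.trans hc) hw
    nlinarith [sq_nonneg (κ * s)]
  · have h1 : (κ + w) * r ≤ (κ + w) * (P * (1 - s) ^ 2 - κ + w / 2) :=
      mul_le_mul_of_nonneg_left (by linarith) (by linarith)
    have main : 0 ≤ w * (P * (1 - (1 - s) ^ 2) - w / 2 - κ * s - κ / 2)
        + κ * s * (P * (1 - s) + κ * s) := by
      rcases le_or_gt s (1 / 2) with hh | hh
      · have a1 : 0 ≤ P * (1 - (1 - s) ^ 2) - w / 2 - κ * s := by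
          have : κ * s ≤ P * s / 2 := by nlinarith
          have : 0 ≤ P * s * (1 - s) := mul_nonneg (mul_nonneg hP0 hs) (by linarith)
          nlinarith
        have a2 : 0 ≤ s * (P * (1 - s)) - w / 2 := by
          nlinarith [mul_nonneg (mul_nonneg hP0 hs) (by linarith : (0:ℝ) ≤ 1 / 2 - s)]
        nlinarith [mul_nonneg hw a1, mul_nonneg hκ a2, sq_nonneg (κ * s)]
      · have a0 : (1 - s) ^ 2 ≤ 1 / 4 := by nlinarith
        have a3 : P * (1 - s) ^ 2 ≤ P / 4 := by nlinarith
        have a4 : κ * s ≤ κ := by nlinarith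
        have a1 : 0 ≤ P * (1 - (1 - s) ^ 2) - w / 2 - κ * s - κ / 2 := by nlinarith
        have a2 : 0 ≤ κ * s * (P * (1 - s) + κ * s) := by
          have : 0 ≤ P * (1 - s) := mul_nonneg hP0 (by linarith)
          positivity
        nlinarith [mul_nonneg hw a1]
    nlinarith

/-! ### Maximal arrangements and the eigenvector equation -/

/-- The quadratic form of the `k × k` arrangement of `μ 1, …, μ (k ^ 2)` given by `e`. -/
def arrangementForm {k : ℕ} (μ : ℕ → ℝ) (e : Fin k × Fin k ≃ Fin (k ^ 2)) (x : Fin k → ℝ) : ℝ :=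
  ∑ p, μ (e p + 1) * (x p.1 * x p.2)

/-- The sorting key of an entry: decreasing in the product, then increasing in the index sum. -/
def entryKey {k : ℕ} (x : Fin k → ℝ) (p : Fin k × Fin k) : ℝ ×ₗ ℕ :=
  toLex (-(x p.1 * x p.2), p.1.val + p.2.val)

/-- Each form is continuous on the compact unit sphere, and there are only finitely many
arrangements. -/
theorem exists_maximal_arrangement {K : ℕ} (μ : ℕ → ℝ) :
    ∃ (e : Fin (K + 1) × Fin (K + 1) ≃ Fin ((K + 1) ^ 2)) (x : Fin (K + 1) → ℝ),
      ∑ i, x i ^ 2 = 1 ∧ ∀ (e' : Fin (K + 1) × Fin (K + 1) ≃ Fin ((K + 1) ^ 2))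
        (y : Fin (K + 1) → ℝ), ∑ i, y i ^ 2 = 1 →
        arrangementForm μ e' y ≤ arrangementForm μ e x := by
  have hex : ∀ e : Fin (K + 1) × Fin (K + 1) ≃ Fin ((K + 1) ^ 2),
      ∃ x : Fin (K + 1) → ℝ, ∑ i, x i ^ 2 = 1 ∧ ∀ y, ∑ i, y i ^ 2 = 1 →
        arrangementForm μ e y ≤ arrangementForm μ e x := by
    intro e
    have hcont : Continuous fun x : EuclideanSpace ℝ (Fin (K + 1)) => arrangementForm μ e x := by
      unfold arrangementForm
      fun_prop
    obtain ⟨x, hx, hmax⟩ := (isCompact_sphere (0 : EuclideanSpace ℝ (Fin (K + 1))) 1).exists_isMaxOn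
      (NormedSpace.sphere_nonempty.2 zero_le_one) hcont.continuousOn
    have hsphere : ∀ y : EuclideanSpace ℝ (Fin (K + 1)),
        y ∈ Metric.sphere (0 : EuclideanSpace ℝ (Fin (K + 1))) 1 ↔ ∑ i, y i ^ 2 = 1 := by
      intro y
      rw [mem_sphere_zero_iff_norm, EuclideanSpace.norm_eq, Real.sqrt_eq_one]
      simp
    refine ⟨x, (hsphere x).1 hx, fun y hy => ?_⟩
    exact hmax (a := WithLp.toLp 2 y) ((hsphere _).2 hy)
  choose X hX1 hX2 using hex
  have : Nonempty (Fin (K + 1) × Fin (K + 1) ≃ Fin ((K + 1) ^ 2)) :=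
    ⟨Fintype.equivFinOfCardEq (by simp [sq])⟩
  obtain ⟨e, he⟩ := Finite.exists_max fun e => arrangementForm μ e (X e)
  exact ⟨e, X e, hX1 e, fun e' y hy => (hX2 e' y hy).trans (he e')⟩

/-- Two moves never decrease the form: replacing x by its sorted absolute values while permuting the
matrix accordingly, and reordering the entries by the products x i * x j. Applied to a global
maximizer they give another one. -/
theorem exists_sorted_maximal_arrangement {K : ℕ} {μ : ℕ → ℝ}
    (hanti : AntitoneOn μ (Set.Icc 1 ((K + 1) ^ 2)))
    (hpos : ∀ i ∈ Set.Icc 1 ((K + 1) ^ 2), 0 ≤ μ i) :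
    ∃ (e : Fin (K + 1) × Fin (K + 1) ≃ Fin ((K + 1) ^ 2)) (x : Fin (K + 1) → ℝ),
      ∑ i, x i ^ 2 = 1 ∧ (∀ (e' : Fin (K + 1) × Fin (K + 1) ≃ Fin ((K + 1) ^ 2))
        (y : Fin (K + 1) → ℝ), ∑ i, y i ^ 2 = 1 →
        arrangementForm μ e' y ≤ arrangementForm μ e x) ∧
      (∀ i, 0 ≤ x i) ∧ Antitone x ∧ ∀ p q, entryKey x p < entryKey x q → e p < e q := by
  obtain ⟨e, x, hx, hmax⟩ := exists_maximal_arrangement (K := K) μ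
  let τ := Tuple.sort fun i => -|x i|
  have hτ := Tuple.monotone_sort fun i => -|x i|
  let z : Fin (K + 1) → ℝ := fun i => |x (τ i)|
  have hz : Antitone z := fun i j hij => by simpa [τ] using hτ hij
  have hz0 : ∀ i, 0 ≤ z i := fun i => abs_nonneg _
  have hz1 : ∑ i, z i ^ 2 = 1 := by
    rw [← hx, ← Equiv.sum_comp τ (fun i => x i ^ 2)]
    simp [z]
  let e1 := (Equiv.prodCongr τ τ).trans e
  have h1 : arrangementForm μ e x ≤ arrangementForm μ e1 z := by
    unfold arrangementForm
    rw [← Equiv.sum_comp (Equiv.prodCongr τ τ)]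
    refine Finset.sum_le_sum fun p _ => ?_
    refine mul_le_mul_of_nonneg_left ?_ (hpos _ ⟨by omega, by omega⟩)
    exact (le_abs_self _).trans (abs_mul _ _).le
  obtain ⟨e2, he2⟩ := exists_equiv_fin_of_key (N := (K + 1) ^ 2) (by simp [sq]) (entryKey z)
  have h2 : arrangementForm μ e1 z ≤ arrangementForm μ e2 z := by
    refine sum_mul_le_of_subset_sums (fun p => mul_nonneg (hz0 _) (hz0 _)) e2 ?_
      (subset_sums_of_equiv hanti hpos e1)
    intro p q hpq
    exact he2 p q (Prod.Lex.toLex_lt_toLex.2 (Or.inl (neg_lt_neg hpq)))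
  exact ⟨e2, z, hz1, fun e' y hy => (hmax e' y hy).trans (h1.trans h2), hz0, hz, he2⟩

/-- A maximizer of a quadratic form on the unit sphere is an eigenvector of its symmetrization. -/
theorem eigenvector_of_maximal {k : ℕ} {M : Fin k → Fin k → ℝ} {x : Fin k → ℝ} {l : ℝ}
    (hx : ∑ i, x i ^ 2 = 1) (hl : ∑ i, ∑ j, M i j * (x i * x j) = l)
    (hmax : ∀ y : Fin k → ℝ, ∑ i, y i ^ 2 = 1 → ∑ i, ∑ j, M i j * (y i * y j) ≤ l) (a : Fin k) :
    ∑ j, (M a j + M j a) * x j = 2 * l * x a := by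
  have hhom : ∀ y : Fin k → ℝ, ∑ i, ∑ j, M i j * (y i * y j) ≤ l * ∑ i, y i ^ 2 := by
    intro y
    rcases (Finset.sum_nonneg fun i _ => sq_nonneg (y i)).eq_or_lt' with h0 | h0
    · have hy : ∀ i, y i = 0 := fun i => by
        have := (Finset.sum_eq_zero_iff_of_nonneg fun i _ => sq_nonneg (y i)).1 h0 i
          (Finset.mem_univ i)
        exact pow_eq_zero_iff (two_ne_zero) |>.1 this
      simp [hy]
    · set S := ∑ i, y i ^ 2 with hS
      have h1 := hmax (fun i => y i / √S) (by
        simp only [div_pow, Real.sq_sqrt h0.le]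
        rw [← Finset.sum_div, ← hS, div_self h0.ne'])
      have h2 : ∑ i, ∑ j, M i j * (y i / √S * (y j / √S))
          = (∑ i, ∑ j, M i j * (y i * y j)) / S := by
        rw [Finset.sum_div]
        refine Finset.sum_congr rfl fun i _ => ?_
        rw [Finset.sum_div]
        refine Finset.sum_congr rfl fun j _ => ?_
        rw [div_mul_div_comm, Real.mul_self_sqrt h0.le, mul_div_assoc']
      rw [h2, div_le_iff₀ h0] at h1
      exact h1
  -- Perturb the single coordinate a by ε in the homogeneous inequality; the linear coefficient must
  -- vanish.
  have hvar : ∀ ε : ℝ, ε * (∑ j, (M a j + M j a) * x j - 2 * l * x a) + ε ^ 2 * (M a a - l) ≤ 0 := by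
    intro ε
    have h := hhom (fun i => x i + if i = a then ε else 0)
    have e1 : ∑ i, (x i + if i = a then ε else 0) ^ 2 = 1 + 2 * ε * x a + ε ^ 2 := by
      have : ∀ i, (x i + if i = a then ε else 0) ^ 2
          = x i ^ 2 + if i = a then 2 * ε * x a + ε ^ 2 else 0 := by
        intro i; split_ifs with h
        · subst h; ring
        · ring
      simp only [this, Finset.sum_add_distrib, hx, Finset.sum_ite_eq', Finset.mem_univ, if_true]
      ring
    have e2 : ∑ i, ∑ j, M i j * ((x i + if i = a then ε else 0) * (x j + if j = a then ε else 0))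
        = l + ε * ∑ j, (M a j + M j a) * x j + ε ^ 2 * M a a := by
      have : ∀ i j, M i j * ((x i + if i = a then ε else 0) * (x j + if j = a then ε else 0))
          = M i j * (x i * x j) + (if i = a then ε * (M a j * x j) else 0)
            + (if j = a then ε * (M i a * x i) else 0)
            + (if i = a then if j = a then ε ^ 2 * M a a else 0 else 0) := by
        intro i j
        split_ifs with h h' h'
        · subst h; subst h'; ring
        · subst h; ring
        · subst h'; ring
        · ring
      simp only [this]
      simp only [Finset.sum_add_distrib, hl, Finset.sum_ite_eq', Finset.mem_univ, if_true,
        add_mul, mul_add, Finset.mul_sum]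
      rw [Finset.sum_comm (f := fun i j => if i = a then ε * (M a j * x j) else 0)]
      simp only [Finset.sum_ite_eq', Finset.mem_univ, if_true]
      have h4 : ∑ i, ∑ j, (if i = a then if j = a then ε ^ 2 * M a a else 0 else 0)
          = ε ^ 2 * M a a := by
        rw [Finset.sum_comm]
        simp
      rw [h4]
      ring
    rw [e1, e2] at h
    linarith
  set B := ∑ j, (M a j + M j a) * x j - 2 * l * x a with hB
  suffices B = 0 by linarith
  by_contra hne
  set C := M a a - l
  have hC : 0 < |C| + 1 := by positivity
  -- This ε has the sign of B and is small enough for the linear term to outweigh the quadratic one.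
  have h := hvar (B / (|C| + 1))
  have hBsq : 0 < B ^ 2 := by positivity
  have h5 : B / (|C| + 1) * B + (B / (|C| + 1)) ^ 2 * C
      = B ^ 2 * ((|C| + 1) + C) / (|C| + 1) ^ 2 := by
    field_simp
  rw [h5] at h
  have h6 : 0 < B ^ 2 * ((|C| + 1) + C) / (|C| + 1) ^ 2 := by
    have : 0 < (|C| + 1) + C := by linarith [neg_abs_le C]
    positivity
  linarith

/-! ### Counting positions in a sorted arrangement -/

/-- The index sum in the key keeps the inequality strict when products tie, for instance when
coordinates of x vanish. -/
theorem entryKey_lt_of_le {k : ℕ} {x : Fin k → ℝ} (hx : Antitone x) (hx0 : ∀ i, 0 ≤ x i)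
    {p q : Fin k × Fin k} (h1 : p.1 ≤ q.1) (h2 : p.2 ≤ q.2) (hne : p ≠ q) :
    entryKey x p < entryKey x q := by
  have hprod : x q.1 * x q.2 ≤ x p.1 * x p.2 :=
    mul_le_mul (hx h1) (hx h2) (hx0 _) (hx0 _)
  have hsum : p.1.val + p.2.val < q.1.val + q.2.val := by
    by_contra hcon
    refine hne (Prod.ext (Fin.ext ?_) (Fin.ext ?_)) <;>
    · have := Fin.le_def.1 h1
      have := Fin.le_def.1 h2
      omega
  rcases hprod.lt_or_eq with h | h
  · exact Prod.Lex.toLex_lt_toLex.2 (Or.inl (neg_lt_neg h))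
  · exact Prod.Lex.toLex_lt_toLex.2 (Or.inr ⟨by rw [h], hsum⟩)

theorem entryKey_swap {k : ℕ} (x : Fin k → ℝ) (p : Fin k × Fin k) :
    entryKey x p.swap = entryKey x p := by
  simp [entryKey, mul_comm, add_comm]

section Positions

variable {K : ℕ} {x : Fin (K + 1) → ℝ} {e : Fin (K + 1) × Fin (K + 1) ≃ Fin ((K + 1) ^ 2)}

/-- Entries dominating `(i, j)` or `(j, i)` precede `(i, j)`. -/
theorem position_lt_of_dominates (hx : Antitone x) (hx0 : ∀ i, 0 ≤ x i)
    (he : ∀ p q, entryKey x p < entryKey x q → e p < e q) {p q : Fin (K + 1) × Fin (K + 1)}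
    (h : p.1 ≤ q.1 ∧ p.2 ≤ q.2 ∨ p.1 ≤ q.2 ∧ p.2 ≤ q.1) (h1 : p ≠ q) (h2 : p ≠ q.swap) :
    e p < e q := by
  refine he _ _ ?_
  rcases h with h | h
  · exact entryKey_lt_of_le hx hx0 h.1 h.2 h1
  · rw [← entryKey_swap x q]
    exact entryKey_lt_of_le hx hx0 h.1 h.2 h2

/-- The j entries of row 0 before column j and the j - 1 further entries of column 0 above row j all
precede both (0, j) and (j, 0). -/
theorem position_first_row (hx : Antitone x) (hx0 : ∀ i, 0 ≤ x i)
    (he : ∀ p q, entryKey x p < entryKey x q → e p < e q) (j : Fin (K + 1))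
    {q : Fin (K + 1) × Fin (K + 1)} (hq : q = (0, j) ∨ q = (j, 0)) :
    2 * j.val - 1 ≤ (e q).val := by
  have hcard : ((Finset.univ.filter fun p : Fin (K + 1) × Fin (K + 1) =>
      (p.1 = 0 ∧ p.2 < j) ∨ (p.2 = 0 ∧ 0 < p.1 ∧ p.1 < j))).card = 2 * j.val - 1 := by
    rw [Finset.filter_or, Finset.card_union_of_disjoint]
    · have h1 : (Finset.univ.filter fun p : Fin (K + 1) × Fin (K + 1) => p.1 = 0 ∧ p.2 < j)
          = {0} ×ˢ Finset.Iio j := by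
        ext p
        simp only [Finset.mem_filter, Finset.mem_univ, true_and, Finset.mem_product,
          Finset.mem_singleton, Finset.mem_Iio]
      have h2 : (Finset.univ.filter fun p : Fin (K + 1) × Fin (K + 1) =>
          p.2 = 0 ∧ 0 < p.1 ∧ p.1 < j) = Finset.Ioo 0 j ×ˢ {0} := by
        ext p
        simp only [Finset.mem_filter, Finset.mem_univ, true_and, Finset.mem_product,
          Finset.mem_singleton, Finset.mem_Ioo]
        tauto
      rw [h1, h2]
      simp
      omega
    · rw [Finset.disjoint_filter]
      rintro p - ⟨h, -⟩ ⟨-, h', -⟩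
      exact absurd h h'.ne'
  rw [← hcard]
  refine card_le_of_forall_lt e _ _ ?_
  rintro ⟨a, b⟩ hp
  simp only [Finset.mem_filter, Finset.mem_univ, true_and] at hp
  rcases hq with rfl | rfl <;> refine position_lt_of_dominates hx hx0 he ?_ ?_ ?_ <;>
    simp only [Prod.swap, ne_eq, Prod.mk.injEq, Fin.le_def, Fin.lt_def, Fin.ext_iff,
      Fin.val_zero] at hp ⊢ <;> omega

/-- Every entry with some index at most j dominates (K, j) or its transpose. Their number is (K+1)²
- (K-j)², and 2 is subtracted because (K, j) and (j, K) share a key and their mutual order is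
undetermined. -/
theorem position_last_row (hx : Antitone x) (hx0 : ∀ i, 0 ≤ x i)
    (he : ∀ p q, entryKey x p < entryKey x q → e p < e q) (j : Fin K)
    {q : Fin (K + 1) × Fin (K + 1)} (hq : q = (Fin.last K, j.castSucc) ∨
      q = (j.castSucc, Fin.last K)) :
    (K + 1) ^ 2 - (K - j.val) ^ 2 - 2 ≤ (e q).val := by
  classical
  have hj := j.isLt
  have hcompl : (Finset.univ.filter fun p : Fin (K + 1) × Fin (K + 1) =>
      ¬ (p.1 ≤ j.castSucc ∨ p.2 ≤ j.castSucc)).card = (K - j.val) ^ 2 := by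
    have : (Finset.univ.filter fun p : Fin (K + 1) × Fin (K + 1) =>
      ¬ (p.1 ≤ j.castSucc ∨ p.2 ≤ j.castSucc)) = Finset.Ioi j.castSucc ×ˢ Finset.Ioi j.castSucc := by
      ext p; simp
    rw [this, Finset.card_product, Fin.card_Ioi]
    simp [sq]
  have hall := Finset.card_filter_add_card_filter_not (s := Finset.univ)
    (fun p : Fin (K + 1) × Fin (K + 1) => p.1 ≤ j.castSucc ∨ p.2 ≤ j.castSucc)
  rw [hcompl] at hall
  have hcard := Finset.le_card_sdiff {(Fin.last K, j.castSucc), (j.castSucc, Fin.last K)}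
    (Finset.univ.filter fun p : Fin (K + 1) × Fin (K + 1) =>
      p.1 ≤ j.castSucc ∨ p.2 ≤ j.castSucc)
  have h2 : ({(Fin.last K, j.castSucc), (j.castSucc, Fin.last K)} :
      Finset (Fin (K + 1) × Fin (K + 1))).card ≤ 2 := Finset.card_le_two
  have hu : (Finset.univ : Finset (Fin (K + 1) × Fin (K + 1))).card = (K + 1) ^ 2 := by simp [sq]
  rw [hu] at hall
  refine le_trans (by omega) (card_le_of_forall_lt e
    ((Finset.univ.filter fun p : Fin (K + 1) × Fin (K + 1) =>
      p.1 ≤ j.castSucc ∨ p.2 ≤ j.castSucc) \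
      {(Fin.last K, j.castSucc), (j.castSucc, Fin.last K)}) q ?_)
  rintro ⟨a, b⟩ hp
  simp only [Finset.mem_sdiff, Finset.mem_filter, Finset.mem_univ, true_and, Finset.mem_insert,
    Finset.mem_singleton, not_or] at hp
  obtain ⟨h1, h3, h4⟩ := hp
  have ha := Fin.le_last a
  have hb := Fin.le_last b
  rcases hq with rfl | rfl
  · exact position_lt_of_dominates hx hx0 he (by simp only [ha, hb, true_and, and_true]; tauto) h3 h4
  · exact position_lt_of_dominates hx hx0 he (by simp only [ha, hb, true_and, and_true]; tauto) h4 h3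

theorem position_last (hx : Antitone x) (hx0 : ∀ i, 0 ≤ x i)
    (he : ∀ p q, entryKey x p < entryKey x q → e p < e q) :
    (K + 1) ^ 2 - 1 ≤ (e (Fin.last K, Fin.last K)).val := by
  classical
  have := card_le_of_forall_lt e (Finset.univ.erase (Fin.last K, Fin.last K)) _ (by
    intro p hp
    exact position_lt_of_dominates hx hx0 he (Or.inl ⟨Fin.le_last _, Fin.le_last _⟩)
      (Finset.ne_of_mem_erase hp) (Finset.ne_of_mem_erase hp))
  simpa [sq] using this

end Positions

/-! ### Row sums and the Ledermann-type bound on arrangements -/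

theorem firstRowSum_succ (μ : ℕ → ℝ) (K : ℕ) :
    firstRowSum μ (K + 1) = μ 1 + ∑ i ∈ Finset.range K, μ (2 * i + 2) := by
  unfold firstRowSum
  congr 1
  rw [← Finset.Ico_add_one_right_eq_Icc, Finset.sum_Ico_eq_sum_range]
  refine Finset.sum_congr (by congr 1) fun i _ => ?_
  congr 1; omega

theorem lastRowSum_succ (μ : ℕ → ℝ) (K : ℕ) :
    lastRowSum μ (K + 1) = ∑ i ∈ Finset.range (K + 1), μ ((K + 1) ^ 2 - (K - i) ^ 2) := by
  unfold lastRowSum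
  rw [← Finset.Ico_add_one_right_eq_Icc, Finset.sum_Ico_eq_sum_range]
  refine Finset.sum_congr (by congr 1) fun i _ => ?_
  congr 3; omega

section RowSums

variable {K : ℕ} {μ : ℕ → ℝ}

theorem shell_index_add_two_le {K i : ℕ} (hi : i < K) :
    (K + 1) ^ 2 - (K - i) ^ 2 + 1 ≤ (K + 1) ^ 2 - (K - (i + 1)) ^ 2 := by
  obtain ⟨d, rfl⟩ : ∃ d, K = i + 1 + d := ⟨K - (i + 1), by omega⟩
  have h1 : i + 1 + d - i = d + 1 := by omega
  have h2 : i + 1 + d - (i + 1) = d := by omega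
  rw [h1, h2]
  have h3 : (d + 1) ^ 2 ≤ (i + 1 + d + 1) ^ 2 := Nat.pow_le_pow_left (by omega) 2
  have h4 : (d + 1) ^ 2 = d ^ 2 + 2 * d + 1 := by ring
  omega

theorem two_mul_add_one_le_shell_index {K i : ℕ} :
    2 * K + 1 ≤ (K + 1) ^ 2 - (K - i) ^ 2 := by
  have h3 : (K - i) ^ 2 ≤ K ^ 2 := Nat.pow_le_pow_left (by omega) 2
  have h4 : (K + 1) ^ 2 = K ^ 2 + 2 * K + 1 := by ring
  omega

/-- The last row sum of the symmetrized matrix exceeds that of the matrix of coefficients by a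
telescoping amount. -/
theorem sum_pred_shell_le (hanti : AntitoneOn μ (Set.Icc 1 ((K + 1) ^ 2))) {N : ℕ} (hN : N < K) :
    ∑ i ∈ Finset.range (N + 1), μ ((K + 1) ^ 2 - (K - i) ^ 2 - 1)
        + μ ((K + 1) ^ 2 - (K - N) ^ 2)
      ≤ μ (2 * K) + ∑ i ∈ Finset.range (N + 1), μ ((K + 1) ^ 2 - (K - i) ^ 2) := by
  induction N with
  | zero =>
    have : (K + 1) ^ 2 - K ^ 2 - 1 = 2 * K := by
      have h4 : (K + 1) ^ 2 = K ^ 2 + 2 * K + 1 := by ring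
      omega
    simp [this]
  | succ N ih =>
    have h := ih (by omega)
    rw [Finset.sum_range_succ _ (N + 1), Finset.sum_range_succ _ (N + 1)]
    have h1 := shell_index_add_two_le (K := K) (i := N) (by omega)
    have h2 := two_mul_add_one_le_shell_index (K := K) (i := N)
    -- Successive shell indices differ by at least one, so each shifted term is absorbed by the
    -- unshifted term of the previous shell.
    have := hanti (a := (K + 1) ^ 2 - (K - N) ^ 2) (b := (K + 1) ^ 2 - (K - (N + 1)) ^ 2 - 1)
      ⟨by omega, by omega⟩ ⟨by omega, by omega⟩ (by omega)
    linarith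

/-- The bound on every arrangement, for `k = K + 1 ≥ 2`. -/
theorem arrangementForm_le_etaBound_of_two_le (hK : 1 ≤ K)
    (hanti : AntitoneOn μ (Set.Icc 1 ((K + 1) ^ 2)))
    (hpos : ∀ i ∈ Set.Icc 1 ((K + 1) ^ 2), 0 ≤ μ i)
    (e' : Fin (K + 1) × Fin (K + 1) ≃ Fin ((K + 1) ^ 2)) (y : Fin (K + 1) → ℝ)
    (hy : ∑ i, y i ^ 2 = 1) : arrangementForm μ e' y ≤ etaBound μ (K + 1) := by
  obtain ⟨e, x, hx1, hmax, hx0, hx, he⟩ := exists_sorted_maximal_arrangement hanti hpos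
  refine (hmax e' y hy).trans ?_
  have hsq : (K + 1) ^ 2 = K ^ 2 + 2 * K + 1 := by ring
  have hKK : K ≤ K ^ 2 := Nat.le_self_pow two_ne_zero K
  set l := arrangementForm μ e x with hl
  set M : Fin (K + 1) → Fin (K + 1) → ℝ := fun i j => μ (e (i, j) + 1) with hM
  have heig := eigenvector_of_maximal (M := M) hx1 (l := l)
    (by rw [hl, arrangementForm, Fintype.sum_prod_type])
    (fun z hz => by
      have := hmax e z hz
      rwa [arrangementForm, Fintype.sum_prod_type] at this)
  have hmono : ∀ i : ℕ, 1 ≤ i → ∀ p, i ≤ (e p).val + 1 → μ (e p + 1) ≤ μ i := fun i hi p hp =>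
    hanti ⟨hi, hp.trans (e p).isLt⟩ ⟨by omega, (e p).isLt⟩ hp
  have hMpos : ∀ p, 0 ≤ μ (e p + 1) := fun p => hpos _ ⟨by omega, (e p).isLt⟩
  set h := μ (2 * K) with hh
  set κ := μ ((K + 1) ^ 2) with hκ
  set P := firstRowSum μ (K + 1) with hP
  set p := lastRowSum μ (K + 1) with hp
  have hκ0 : 0 ≤ κ := hpos _ ⟨by omega, le_rfl⟩
  have hκh : κ ≤ h := hanti ⟨by omega, by omega⟩ ⟨by omega, le_rfl⟩ (by omega)
  -- bounds on the entries of the first row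
  have hrow0 : ∀ j : Fin (K + 1), j ≠ 0 → M 0 j + M j 0 ≤ 2 * μ (2 * j) := by
    intro j hj
    have hj' : 1 ≤ j.val := Nat.one_le_iff_ne_zero.2 fun h => hj (Fin.ext h)
    have h1 := hmono (2 * j) (by omega) (0, j)
      (by have := position_first_row hx hx0 he j (Or.inl rfl); omega)
    have h2 := hmono (2 * j) (by omega) (j, 0)
      (by have := position_first_row hx hx0 he j (Or.inr rfl); omega)
    simp only [hM]
    linarith
  have hrowK : ∀ j : Fin K, M (Fin.last K) j.castSucc + M j.castSucc (Fin.last K)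
      ≤ μ ((K + 1) ^ 2 - (K - j) ^ 2 - 1) + μ ((K + 1) ^ 2 - (K - j) ^ 2) := by
    intro j
    have h1 := position_last_row hx hx0 he j (Or.inl rfl)
    have h2 := position_last_row hx hx0 he j (Or.inr rfl)
    have h3 := two_mul_add_one_le_shell_index (K := K) (i := j)
    -- The two transposed entries occupy distinct positions, so the later one lies one place
    -- further, which gains one index.
    have hne : (e (Fin.last K, j.castSucc)).val ≠ (e (j.castSucc, Fin.last K)).val := by
      intro h
      have := congrArg Prod.fst (e.injective (Fin.ext h))
      exact absurd this (Fin.castSucc_lt_last j).ne'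
    simp only [hM]
    rcases Nat.lt_or_gt_of_ne hne with h | h
    · exact add_le_add (hmono _ (by omega) _ (by omega)) (hmono _ (by omega) _ (by omega))
    · rw [add_comm]
      exact add_le_add (hmono _ (by omega) _ (by omega)) (hmono _ (by omega) _ (by omega))
  have hMKK : M (Fin.last K) (Fin.last K) ≤ κ :=
    hmono _ (by omega) _ (by have := position_last hx hx0 he; omega)
  -- row sums
  set P' := ∑ j : Fin K, (M 0 j.castSucc + M j.castSucc 0) with hP'
  set r' := ∑ j : Fin K, (M (Fin.last K) j.castSucc + M j.castSucc (Fin.last K)) with hr'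
  obtain ⟨L, rfl⟩ : ∃ L, K = L + 1 := ⟨K - 1, by omega⟩
  have hPdef : P = μ 1 + ∑ i ∈ Finset.range L, μ (2 * i + 2) + h := by
    rw [hP, firstRowSum_succ, Finset.sum_range_succ, hh, ← add_assoc]
    congr 2
  have hM00 : M 0 0 ≤ μ 1 := hmono 1 le_rfl _ (by omega)
  have hPle : P' ≤ 2 * (P - h) := by
    rw [hP', Fin.sum_univ_succ, hPdef, ← Fin.sum_univ_eq_sum_range (fun i => μ (2 * i + 2))]
    have : ∑ i : Fin L, (M 0 i.succ.castSucc + M i.succ.castSucc 0)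
        ≤ ∑ i : Fin L, 2 * μ (2 * i + 2) := by
      refine Finset.sum_le_sum fun i _ => ?_
      exact hrow0 i.succ.castSucc (by simp [Fin.ext_iff])
    rw [← Finset.mul_sum] at this
    simp only [Fin.castSucc_zero]
    linarith
  -- All indices bounding the last row are at least 2K, while those in P - h are at most 2K, so a
  -- termwise comparison suffices.
  have hrle1 : r' ≤ 2 * (P - h) := by
    rw [hr', Fin.sum_univ_succ, hPdef, ← Fin.sum_univ_eq_sum_range (fun i => μ (2 * i + 2))]
    have hb : ∀ j : Fin (L + 1), ∀ i : ℕ, 1 ≤ i → i ≤ 2 * (L + 1) →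
        M (Fin.last (L + 1)) j.castSucc + M j.castSucc (Fin.last (L + 1)) ≤ 2 * μ i := by
      intro j i hi1 hi2
      refine (hrowK j).trans ?_
      have h3 := two_mul_add_one_le_shell_index (K := L + 1) (i := j)
      have h4 := hanti (a := i) (b := (L + 1 + 1) ^ 2 - (L + 1 - j.val) ^ 2 - 1)
        ⟨hi1, by omega⟩ ⟨by omega, by omega⟩ (by omega)
      have h5 := hanti (a := i) (b := (L + 1 + 1) ^ 2 - (L + 1 - j.val) ^ 2)
        ⟨hi1, by omega⟩ ⟨by omega, by omega⟩ (by omega)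
      linarith
    have : ∑ i : Fin L, (M (Fin.last (L + 1)) i.succ.castSucc + M i.succ.castSucc (Fin.last (L + 1)))
        ≤ ∑ i : Fin L, 2 * μ (2 * i + 2) :=
      Finset.sum_le_sum fun i _ => hb _ _ (by omega) (by omega)
    rw [← Finset.mul_sum] at this
    have := hb 0 1 le_rfl (by omega)
    linarith
  have hpdef : p = ∑ i ∈ Finset.range (L + 1), μ ((L + 1 + 1) ^ 2 - (L + 1 - i) ^ 2) + κ := by
    rw [hp, lastRowSum_succ, Finset.sum_range_succ]
    simp [hκ]
  -- Lowering half of the indices by one costs only a telescoping h - κ.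
  have hrle2 : r' ≤ 2 * (p - κ) + (h - κ) := by
    have h1 := sum_pred_shell_le hanti (N := L) (by omega)
    have h2 : r' ≤ _ := Finset.sum_le_sum fun j _ => hrowK j
    rw [Finset.sum_add_distrib,
      Fin.sum_univ_eq_sum_range (fun i => μ ((L + 1 + 1) ^ 2 - (L + 1 - i) ^ 2)),
      Fin.sum_univ_eq_sum_range (fun i => μ ((L + 1 + 1) ^ 2 - (L + 1 - i) ^ 2 - 1))] at h2
    have h3 : κ ≤ μ ((L + 1 + 1) ^ 2 - (L + 1 - L) ^ 2) := by
      have := two_mul_add_one_le_shell_index (K := L + 1) (i := L)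
      exact hanti ⟨by omega, by omega⟩ ⟨by omega, le_rfl⟩ (by omega)
    linarith
  have hshell : ∀ i ∈ Finset.range (L + 1), κ ≤ μ ((L + 1 + 1) ^ 2 - (L + 1 - i) ^ 2) ∧
      μ ((L + 1 + 1) ^ 2 - (L + 1 - i) ^ 2) ≤ h := by
    intro i _
    have := two_mul_add_one_le_shell_index (K := L + 1) (i := i)
    exact ⟨hanti ⟨by omega, by omega⟩ ⟨by omega, le_rfl⟩ (by omega),
      hanti ⟨by omega, by omega⟩ ⟨by omega, by omega⟩ (by omega)⟩
  have hp2 : 2 * κ ≤ p := by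
    rw [hpdef, Finset.sum_range_succ]
    have h1 := (hshell L (by simp)).1
    have h2 : 0 ≤ ∑ i ∈ Finset.range L, μ ((L + 1 + 1) ^ 2 - (L + 1 - i) ^ 2) :=
      Finset.sum_nonneg fun i hi => hκ0.trans
        (hshell i (Finset.mem_range.2 (by have := Finset.mem_range.1 hi; omega))).1
    linarith
  have hPlow : ((L : ℝ) + 1) * h ≤ P - h := by
    have h1 : (L : ℝ) * h ≤ ∑ i ∈ Finset.range L, μ (2 * i + 2) := by
      have := Finset.card_nsmul_le_sum (Finset.range L) (fun i => μ (2 * i + 2)) h (by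
        intro i hi
        have := Finset.mem_range.1 hi
        exact hanti ⟨by omega, by omega⟩ ⟨by omega, by omega⟩ (by omega))
      simpa using this
    have h2 : h ≤ μ 1 := hanti ⟨by omega, by omega⟩ ⟨by omega, by omega⟩ (by omega)
    rw [hPdef]
    linarith
  have hpP : p ≤ P := by
    have := Finset.sum_le_card_nsmul (Finset.range (L + 1)) _ h fun i hi => (hshell i hi).2
    rw [hpdef]
    simp only [Finset.card_range, nsmul_eq_mul, Nat.cast_add, Nat.cast_one] at this
    linarith
  have h2P : 2 * h ≤ P := by
    have : 0 ≤ (L : ℝ) * h := mul_nonneg (Nat.cast_nonneg _) (hκ0.trans hκh)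
    linarith
  -- the two eigenvalue inequalities
  have hxpos : 0 < x 0 := by
    refine (hx0 0).lt_of_ne' fun h0 => ?_
    have : ∀ i, x i = 0 := fun i => le_antisymm (h0 ▸ hx (Fin.zero_le i)) (hx0 i)
    simp [this] at hx1
  have hMM : ∀ i j, 0 ≤ M i j := fun i j => hMpos _
  -- In the eigenvector equation at coordinate 0, every coordinate except the last is replaced by
  -- the largest one, x 0; `hlast` does the same at the last coordinate.
  have hfirst : l * x 0 ≤ (P - h) * x 0 + h * x (Fin.last _) := by
    have h1 := heig 0
    rw [Fin.sum_univ_castSucc] at h1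
    have h2 : ∑ j : Fin (L + 1), (M 0 j.castSucc + M j.castSucc 0) * x j.castSucc ≤ P' * x 0 := by
      rw [hP', Finset.sum_mul]
      exact Finset.sum_le_sum fun j _ => mul_le_mul_of_nonneg_left (hx (Fin.zero_le _))
        (add_nonneg (hMM _ _) (hMM _ _))
    have h3 := hrow0 (Fin.last (L + 1)) (by simp [Fin.ext_iff])
    have h4 := mul_le_mul_of_nonneg_right h3 (hx0 (Fin.last (L + 1)))
    have h5 := mul_le_mul_of_nonneg_right hPle hxpos.le
    simp only [Fin.val_last] at h4
    linarith
  have hlast : l * x (Fin.last _) ≤ r' / 2 * x 0 + κ * x (Fin.last _) := by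
    have h1 := heig (Fin.last _)
    rw [Fin.sum_univ_castSucc] at h1
    have h2 : ∑ j : Fin (L + 1), (M (Fin.last _) j.castSucc + M j.castSucc (Fin.last _))
        * x j.castSucc ≤ r' * x 0 := by
      rw [hr', Finset.sum_mul]
      exact Finset.sum_le_sum fun j _ => mul_le_mul_of_nonneg_left (hx (Fin.zero_le _))
        (add_nonneg (hMM _ _) (hMM _ _))
    have h4 := mul_le_mul_of_nonneg_right hMKK (hx0 (Fin.last (L + 1)))
    linarith
  -- conclusion
  have hp0 : 0 ≤ p := by linarith
  have hP0 : 0 ≤ P := hp0.trans hpP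
  have hPt : P * (√(p / P)) ^ 2 = p := by
    rw [Real.sq_sqrt (div_nonneg hp0 hP0)]
    -- If P = 0 the quotient is 0 by convention, and p = 0 as well.
    rcases hP0.eq_or_lt with h0 | h0
    · rw [← h0] at hpP ⊢
      linarith
    · field_simp
  have ht1 : √(p / P) ≤ 1 := Real.sqrt_le_one.2 (div_le_one_of_le₀ hpP hP0)
  have ht0 : 0 ≤ √(p / P) := Real.sqrt_nonneg _
  change l ≤ P - κ * (1 - √(p / P))
  set t := √(p / P)
  -- The two factors on the right are l - P + h and l - κ evaluated at l = P - κ(1 - t). A larger l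
  -- would make their product exceed h * (r' / 2), whereas multiplying the two coordinate
  -- inequalities and cancelling x 0 > 0 forbids this.
  have halg := ledermann_algebra (r := r' / 2) hκ0 hκh h2P ht0 ht1 (by rw [hPt]; exact hp2)
    (by rw [hPt]; linarith) (by linarith)
  by_contra hcon
  rw [not_le] at hcon
  have hA : 0 ≤ h - κ * (1 - t) := by nlinarith
  have hB : 0 ≤ P - 2 * κ + κ * t := by nlinarith
  have hA' : h - κ * (1 - t) < l - P + h := by linarith
  have hB' : P - 2 * κ + κ * t < l - κ := by linarith
  have h1 : h * (r' / 2) < (l - P + h) * (l - κ) :=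
    halg.trans_lt (mul_lt_mul'' hA' hB' hA hB)
  have h2 : (l - P + h) * x 0 ≤ h * x (Fin.last _) := by linarith
  have h3 : (l - κ) * x (Fin.last _) ≤ r' / 2 * x 0 := by linarith
  have h4 := mul_le_mul_of_nonneg_left h3 (hκ0.trans hκh)
  have h5 := mul_le_mul_of_nonneg_right h2 (hB.trans hB'.le)
  have h6 := mul_lt_mul_of_pos_right h1 hxpos
  linarith

end RowSums

theorem arrangementForm_le_etaBound {k : ℕ} {μ : ℕ → ℝ} (hk : 1 ≤ k)
    (hanti : AntitoneOn μ (Set.Icc 1 (k ^ 2))) (hpos : ∀ i ∈ Set.Icc 1 (k ^ 2), 0 ≤ μ i)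
    (e : Fin k × Fin k ≃ Fin (k ^ 2)) (y : Fin k → ℝ) (hy : ∑ i, y i ^ 2 = 1) :
    arrangementForm μ e y ≤ etaBound μ k := by
  obtain ⟨K, rfl⟩ : ∃ K, k = K + 1 := ⟨k - 1, by omega⟩
  rcases Nat.eq_zero_or_pos K with rfl | hK
  · have h1 : y 0 * y 0 = 1 := by simpa [sq] using hy
    -- For k = 1 both row sums equal μ 1, so η = μ 1; if μ 1 = 0 the value of the square root is
    -- multiplied by zero.
    have h3 : √(μ 1 / μ 1) = 1 ∨ μ 1 = 0 := by
      by_cases h : μ 1 = 0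
      · exact Or.inr h
      · left; simp [h]
    have h4 : arrangementForm μ e y = μ 1 := by
      unfold arrangementForm
      rw [Fintype.sum_prod_type]
      simp [h1]
    rw [h4]
    rcases h3 with h3 | h3 <;> simp [etaBound, firstRowSum, lastRowSum, h3]
  · exact arrangementForm_le_etaBound_of_two_le hK hanti hpos e y hy

/-! ### From operators to arrangements: Bessel's inequality -/

/-- The matrix element `⟨u l | A | u l'⟩`, for `p = (l, l')`. -/
def matrixElement {d k : ℕ} (u : Fin k → EuclideanSpace ℂ (Fin d)) (A : Matrix (Fin d) (Fin d) ℂ)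
    (p : Fin k × Fin k) : ℂ :=
  ∑ a, ∑ b, star (u p.1 a) * A a b * u p.2 b

/-- A matrix as a vector of the Hilbert–Schmidt space. -/
def hsVec {d : ℕ} (A : Matrix (Fin d) (Fin d) ℂ) : EuclideanSpace ℂ (Fin d × Fin d) :=
  WithLp.toLp 2 fun p => A p.1 p.2

theorem inner_hsVec {d : ℕ} (A B : Matrix (Fin d) (Fin d) ℂ) :
    inner ℂ (hsVec A) (hsVec B) = (A.conjTranspose * B).trace := by
  simp only [hsVec, PiLp.inner_apply, RCLike.inner_apply, Matrix.trace, Matrix.diag_apply,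
    Matrix.mul_apply, Matrix.conjTranspose_apply, Fintype.sum_prod_type]
  rw [Finset.sum_comm]
  simp [mul_comm]

theorem HSOrthonormal.orthonormal {d N : ℕ} {A : Fin N → Matrix (Fin d) (Fin d) ℂ}
    (hA : HSOrthonormal A) : Orthonormal ℂ fun i => hsVec (A i) := by
  rw [orthonormal_iff_ite]
  exact fun i j => (inner_hsVec _ _).trans (hA i j)

/-- The matrix units `|u l⟩⟨u l'|`. -/
def dyad {d k : ℕ} (u : Fin k → EuclideanSpace ℂ (Fin d)) (p : Fin k × Fin k) :
    Matrix (Fin d) (Fin d) ℂ :=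
  Matrix.of fun a b => u p.1 a * star (u p.2 b)

theorem inner_dyad {d k : ℕ} (u : Fin k → EuclideanSpace ℂ (Fin d))
    (A : Matrix (Fin d) (Fin d) ℂ) (p : Fin k × Fin k) :
    inner ℂ (hsVec (dyad u p)) (hsVec A) = matrixElement u A p := by
  simp only [hsVec, dyad, matrixElement, PiLp.inner_apply, RCLike.inner_apply,
    Fintype.sum_prod_type, Matrix.of_apply, map_mul, RCLike.star_def, Complex.conj_conj]
  refine Finset.sum_congr rfl fun a _ => Finset.sum_congr rfl fun b _ => ?_
  ring

theorem orthonormal_dyad {d k : ℕ} {u : Fin k → EuclideanSpace ℂ (Fin d)}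
    (hu : Orthonormal ℂ u) : Orthonormal ℂ fun p => hsVec (dyad u p) := by
  rw [orthonormal_iff_ite] at hu ⊢
  rintro ⟨a, b⟩ ⟨c, d'⟩
  have h : inner ℂ (hsVec (dyad u (a, b))) (hsVec (dyad u (c, d')))
      = inner ℂ (u a) (u c) * inner ℂ (u d') (u b) := by
    simp only [hsVec, dyad, PiLp.inner_apply, RCLike.inner_apply,
      Fintype.sum_prod_type, Matrix.of_apply, map_mul, RCLike.star_def, Complex.conj_conj]
    rw [Finset.sum_mul_sum]
    refine Finset.sum_congr rfl fun a _ => Finset.sum_congr rfl fun b _ => ?_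
    ring
  rw [h, hu, hu]
  by_cases h1 : a = c <;> by_cases h2 : d' = b <;> simp [h1, h2]
  intro h3; exact h2 h3.symm

/-- Bessel's inequality for the orthonormal dyads against the unit vector `A i`. The primed version
exchanges the roles: the operators `A (f i)` are the orthonormal family and a dyad is the unit
vector. -/
theorem sum_sq_matrixElement_le_one {d k N : ℕ} {u : Fin k → EuclideanSpace ℂ (Fin d)}
    (hu : Orthonormal ℂ u) {A : Fin N → Matrix (Fin d) (Fin d) ℂ} (hA : HSOrthonormal A)
    (i : Fin N) (S : Finset (Fin k × Fin k)) :
    ∑ p ∈ S, ‖matrixElement u (A i) p‖ ^ 2 ≤ 1 := by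
  have h := (orthonormal_dyad hu).sum_inner_products_le (hsVec (A i)) (s := S)
  rw [hA.orthonormal.1 i] at h
  simpa [inner_dyad] using h

theorem sum_sq_matrixElement_le_one' {d k N M : ℕ} {u : Fin k → EuclideanSpace ℂ (Fin d)}
    (hu : Orthonormal ℂ u) {A : Fin N → Matrix (Fin d) (Fin d) ℂ} (hA : HSOrthonormal A)
    {f : Fin M → Fin N} (hf : Function.Injective f) (p : Fin k × Fin k) :
    ∑ i, ‖matrixElement u (A (f i)) p‖ ^ 2 ≤ 1 := by
  have h := (hA.orthonormal.comp f hf).sum_inner_products_le (hsVec (dyad u p)) (s := Finset.univ)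
  rw [(orthonormal_dyad hu).1 p] at h
  refine le_trans (le_of_eq ?_) (h.trans (by norm_num))
  refine Finset.sum_congr rfl fun i _ => ?_
  rw [← inner_dyad, norm_inner_symm]
  rfl

theorem sum_kronecker_eq {m n k : ℕ} (A : Matrix (Fin m) (Fin m) ℂ) (B : Matrix (Fin n) (Fin n) ℂ)
    (s : Fin k → ℝ) (u : Fin k → EuclideanSpace ℂ (Fin m)) (v : Fin k → EuclideanSpace ℂ (Fin n))
    {Ψ : EuclideanSpace ℂ (Fin m × Fin n)}
    (hΨ : ∀ i j, Ψ (i, j) = ∑ l, (s l : ℂ) * u l i * v l j) :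
    ∑ a, ∑ b, star (Ψ a) * (A ⊗ₖ B) a b * Ψ b
      = ∑ p : Fin k × Fin k, ((s p.1 * s p.2 : ℝ) : ℂ)
          * (matrixElement u A p * matrixElement v B p) := by
  have h1 : ∀ a b, star (Ψ a) * (A ⊗ₖ B) a b * Ψ b
      = ∑ p : Fin k × Fin k, ((s p.1 * s p.2 : ℝ) : ℂ)
        * ((star (u p.1 a.1) * A a.1 b.1 * u p.2 b.1)
          * (star (v p.1 a.2) * B a.2 b.2 * v p.2 b.2)) := by
    rintro ⟨i, j⟩ ⟨i', j'⟩
    rw [hΨ, hΨ, star_sum, Finset.sum_mul, Finset.sum_mul_sum, Fintype.sum_prod_type]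
    refine Finset.sum_congr rfl fun l _ => Finset.sum_congr rfl fun l' _ => ?_
    simp only [Matrix.kroneckerMap_apply, star_mul', RCLike.star_def, Complex.conj_ofReal,
      Complex.ofReal_mul]
    ring
  simp only [h1]
  have h2 : ∀ a : Fin m × Fin n, ∑ b : Fin m × Fin n, ∑ p : Fin k × Fin k,
      ((s p.1 * s p.2 : ℝ) : ℂ) * ((star (u p.1 a.1) * A a.1 b.1 * u p.2 b.1)
          * (star (v p.1 a.2) * B a.2 b.2 * v p.2 b.2))
      = ∑ p : Fin k × Fin k, ∑ b : Fin m × Fin n,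
      ((s p.1 * s p.2 : ℝ) : ℂ) * ((star (u p.1 a.1) * A a.1 b.1 * u p.2 b.1)
          * (star (v p.1 a.2) * B a.2 b.2 * v p.2 b.2)) := fun a => Finset.sum_comm
  simp only [h2]
  rw [Finset.sum_comm]
  refine Finset.sum_congr rfl fun p _ => ?_
  simp only [← Finset.mul_sum]
  congr 1
  unfold matrixElement
  rw [Finset.sum_mul_sum, Fintype.sum_prod_type]
  refine Finset.sum_congr rfl fun i _ => Finset.sum_congr rfl fun j _ => ?_
  rw [Finset.sum_mul_sum, Fintype.sum_prod_type]

/-- The expectation value in a vector with `k`-term Schmidt decomposition is dominated by an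
arrangement of the operator Schmidt coefficients. -/
theorem exists_expectation_le_arrangementForm {m n k : ℕ} (hmn : m ≤ n) (hkm : k ≤ m)
    {X : Matrix (Fin m × Fin n) (Fin m × Fin n) ℂ} {μ : ℕ → ℝ} (hμ : IsOperatorSchmidtCoeffs X μ)
    {s : Fin k → ℝ} (hs : ∀ l, 0 ≤ s l) {u : Fin k → EuclideanSpace ℂ (Fin m)}
    {v : Fin k → EuclideanSpace ℂ (Fin n)} (hu : Orthonormal ℂ u) (hv : Orthonormal ℂ v)
    {Ψ : EuclideanSpace ℂ (Fin m × Fin n)}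
    (hΨ : ∀ i j, Ψ (i, j) = ∑ l, (s l : ℂ) * u l i * v l j) :
    ∃ e : Fin k × Fin k ≃ Fin (k ^ 2), expectation X Ψ ≤ arrangementForm μ e s := by
  obtain ⟨hanti, hpos, A, B, hA, hB, hX⟩ := hμ
  set N := min (m ^ 2) (n ^ 2) with hN
  have hkN : k ^ 2 ≤ N := le_min (Nat.pow_le_pow_left hkm 2)
    (Nat.pow_le_pow_left (hkm.trans hmn) 2)
  set α : Fin N → Fin k × Fin k → ℝ := fun i p =>
    ‖matrixElement u (A (Fin.castLE (min_le_left _ _) i)) p‖ with hα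
  set β : Fin N → Fin k × Fin k → ℝ := fun i p =>
    ‖matrixElement v (B (Fin.castLE (min_le_right _ _) i)) p‖ with hβ
  have hexp : expectation X Ψ ≤ ∑ p : Fin k × Fin k,
      (∑ i : Fin N, μ (i + 1) * (α i p * β i p)) * (s p.1 * s p.2) := by
    have h1 : ∑ a, ∑ b, star (Ψ a) * X a b * Ψ b = ∑ i : Fin N, ((μ (i + 1) : ℝ) : ℂ) *
        ∑ p : Fin k × Fin k, ((s p.1 * s p.2 : ℝ) : ℂ)
          * (matrixElement u (A (Fin.castLE (min_le_left _ _) i)) p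
            * matrixElement v (B (Fin.castLE (min_le_right _ _) i)) p) := by
      have h2 : ∀ a b, star (Ψ a) * X a b * Ψ b = ∑ i : Fin N, ((μ (i + 1) : ℝ) : ℂ) *
          (star (Ψ a) * (A (Fin.castLE (min_le_left _ _) i)
            ⊗ₖ B (Fin.castLE (min_le_right _ _) i)) a b * Ψ b) := by
        intro a b
        rw [hX, Matrix.sum_apply, Finset.mul_sum, Finset.sum_mul]
        refine Finset.sum_congr rfl fun i _ => ?_
        rw [Matrix.smul_apply, smul_eq_mul]
        ring
      simp only [h2]
      rw [Finset.sum_congr rfl fun a _ => Finset.sum_comm, Finset.sum_comm]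
      refine Finset.sum_congr rfl fun i _ => ?_
      simp only [← Finset.mul_sum]
      rw [sum_kronecker_eq _ _ s u v hΨ]
    rw [expectation, h1]
    refine (Complex.re_le_norm _).trans ((norm_sum_le _ _).trans ?_)
    simp only [Finset.sum_mul]
    rw [Finset.sum_comm]
    refine Finset.sum_le_sum fun i _ => ?_
    have hμi : 0 ≤ μ (i + 1) := hpos _ ⟨by omega, i.isLt⟩
    rw [norm_mul, Complex.norm_real, Real.norm_of_nonneg hμi]
    refine (mul_le_mul_of_nonneg_left (norm_sum_le _ _) hμi).trans (le_of_eq ?_)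
    rw [Finset.mul_sum]
    refine Finset.sum_congr rfl fun p _ => ?_
    rw [norm_mul, norm_mul, Complex.norm_real, Real.norm_of_nonneg (mul_nonneg (hs _) (hs _))]
    ring
  have hW : ∀ S : Finset (Fin k × Fin k),
      ∑ p ∈ S, ∑ i : Fin N, μ (i + 1) * (α i p * β i p)
        ≤ ∑ i ∈ Finset.range S.card, μ (i + 1) := by
    intro S
    have hS : S.card ≤ N := by
      have := Finset.card_le_univ S
      simp only [Fintype.card_prod, Fintype.card_fin, ← sq] at this
      exact this.trans hkN
    rw [Finset.sum_comm]
    simp only [← Finset.mul_sum]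
    -- The arithmetic–geometric inequality combines the Bessel bounds of the two sides, so that the
    -- weights α β have row and column sums at most 1.
    have hαβ : ∀ i p, α i p * β i p ≤ (α i p ^ 2 + β i p ^ 2) / 2 := fun i p => by
      linarith [two_mul_le_add_sq (α i p) (β i p)]
    have hle : ∀ i, ∑ p ∈ S, α i p * β i p
        ≤ (∑ p ∈ S, α i p ^ 2 + ∑ p ∈ S, β i p ^ 2) / 2 := by
      intro i
      rw [← Finset.sum_add_distrib, Finset.sum_div]
      exact Finset.sum_le_sum fun p _ => hαβ i p
    refine sum_mul_le_sum_first hS hanti hpos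
      (fun i => Finset.sum_nonneg fun p _ => mul_nonneg (norm_nonneg _) (norm_nonneg _))
      (fun i => (hle i).trans ?_) ?_
    · have h1 := sum_sq_matrixElement_le_one hu hA (Fin.castLE (min_le_left _ _) i) S
      have h2 := sum_sq_matrixElement_le_one hv hB (Fin.castLE (min_le_right _ _) i) S
      simp only [hα, hβ]
      linarith
    · rw [Finset.sum_comm]
      have : ∀ p ∈ S, ∑ i, α i p * β i p ≤ 1 := by
        intro p _
        have h1 := sum_sq_matrixElement_le_one' hu hA
          (Fin.castLE_injective (min_le_left (m ^ 2) (n ^ 2))) p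
        have h2 := sum_sq_matrixElement_le_one' hv hB
          (Fin.castLE_injective (min_le_right (m ^ 2) (n ^ 2))) p
        have h3 := Finset.sum_le_sum fun i (_ : i ∈ Finset.univ) => hαβ i p
        rw [← Finset.sum_div, Finset.sum_add_distrib] at h3
        simp only [hα, hβ] at h3 ⊢
        linarith
      simpa using Finset.sum_le_sum this
  obtain ⟨e, he⟩ := exists_equiv_fin_of_key (N := k ^ 2) (by simp [sq])
    fun p : Fin k × Fin k => -(s p.1 * s p.2)
  exact ⟨e, hexp.trans (sum_mul_le_of_subset_sums (fun p => mul_nonneg (hs _) (hs _)) e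
    (fun p q hpq => he p q (neg_lt_neg hpq)) hW)⟩

/-! ### Schmidt decompositions and Schmidt rank -/

/-- The coefficient matrix of a bipartite vector. -/
def coeffMatrix {m n : ℕ} (Ψ : EuclideanSpace ℂ (Fin m × Fin n)) : Matrix (Fin m) (Fin n) ℂ :=
  Matrix.of fun i j => Ψ (i, j)

/-- Singular value decomposition, in Schmidt form. -/
theorem hasSchmidtDecomposition_rank {m n : ℕ} (Ψ : EuclideanSpace ℂ (Fin m × Fin n)) :
    HasSchmidtDecomposition Ψ (coeffMatrix Ψ).rank := by
  set M := coeffMatrix Ψ with hM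
  have hH : (M.conjTranspose * M).IsHermitian := Matrix.isHermitian_conjTranspose_mul_self M
  set lam := hH.eigenvalues with hlam
  have hpos : ∀ j, 0 ≤ lam j := (Matrix.posSemidef_conjTranspose_mul_self M).eigenvalues_nonneg
  set U : Matrix (Fin n) (Fin n) ℂ := hH.eigenvectorUnitary.1 with hU
  have hUU : U.conjTranspose * U = 1 := Unitary.coe_star_mul_self hH.eigenvectorUnitary
  have hUU' : U * U.conjTranspose = 1 := Unitary.coe_mul_star_self hH.eigenvectorUnitary
  set G := M * U with hG
  have hspec : M.conjTranspose * M
      = U * Matrix.diagonal (fun j => (lam j : ℂ)) * U.conjTranspose := by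
    have := hH.spectral_theorem
    rwa [Unitary.conjStarAlgAut_apply] at this
  -- The columns of G = M U are orthogonal with squared norms lam; normalizing the nonzero ones
  -- gives the left Schmidt vectors.
  have hGG : G.conjTranspose * G = Matrix.diagonal (fun j => (lam j : ℂ)) := by
    rw [hG, Matrix.conjTranspose_mul, Matrix.mul_assoc, ← Matrix.mul_assoc _ M U, hspec,
      Matrix.mul_assoc, Matrix.mul_assoc, hUU, Matrix.mul_one,
      ← Matrix.mul_assoc, hUU, Matrix.one_mul]
  have hGsum : ∀ a b, ∑ i, star (G i a) * G i b = if a = b then (lam a : ℂ) else 0 := by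
    intro a b
    have := congrFun (congrFun hGG a) b
    rwa [Matrix.mul_apply, Matrix.diagonal_apply] at this
  have hUsum : ∀ a b, ∑ i, star (U i a) * U i b = if a = b then (1 : ℂ) else 0 := by
    intro a b
    have := congrFun (congrFun hUU a) b
    rwa [Matrix.mul_apply, Matrix.one_apply] at this
  have hMG : ∀ i j, M i j = ∑ a, G i a * star (U j a) := by
    intro i j
    have : M = G * U.conjTranspose := by rw [hG, Matrix.mul_assoc, hUU', Matrix.mul_one]
    conv_lhs => rw [this]
    rw [Matrix.mul_apply]
    rfl
  have hG0 : ∀ a, lam a = 0 → ∀ i, G i a = 0 := by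
    intro a ha i
    have h1 : ∑ i, Complex.normSq (G i a) = 0 := by
      have := hGsum a a
      rw [if_pos rfl, ha] at this
      have h2 : ((∑ i, Complex.normSq (G i a) : ℝ) : ℂ) = 0 := by
        rw [Complex.ofReal_sum, ← Complex.ofReal_zero, ← this]
        exact Finset.sum_congr rfl fun i _ => Complex.normSq_eq_conj_mul_self
      exact_mod_cast h2
    have := (Finset.sum_eq_zero_iff_of_nonneg fun i _ => Complex.normSq_nonneg _).1 h1 i
      (Finset.mem_univ i)
    exact Complex.normSq_eq_zero.1 this
  have hcard : Fintype.card {j // lam j ≠ 0} = M.rank := by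
    rw [← hH.rank_eq_card_non_zero_eigs, Matrix.rank_conjTranspose_mul_self]
  let e : Fin M.rank ≃ {j // lam j ≠ 0} := (Fintype.equivFinOfCardEq hcard).symm
  have hlpos : ∀ l, 0 < lam (e l) := fun l => (hpos _).lt_of_ne' (e l).2
  have hspos : ∀ l, 0 < √(lam (e l)) := fun l => Real.sqrt_pos.2 (hlpos l)
  -- The right vectors are conjugated columns of U, since a Schmidt decomposition multiplies u and v
  -- without conjugation.
  refine ⟨fun l => √(lam (e l)), fun l => WithLp.toLp 2 fun i => G i (e l) / (√(lam (e l)) : ℂ),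
    fun l => WithLp.toLp 2 fun j => star (U j (e l)), hspos, ?_, ?_, ?_⟩
  · rw [orthonormal_iff_ite]
    intro a b
    simp only [PiLp.inner_apply, RCLike.inner_apply, map_div₀, Complex.conj_ofReal]
    have h1 : ∀ i, G i (e b) / (√(lam (e b)) : ℂ) * ((starRingEnd ℂ) (G i (e a)) / (√(lam (e a)) : ℂ))
        = star (G i (e a)) * G i (e b) / ((√(lam (e b)) : ℂ) * (√(lam (e a)) : ℂ)) := by
      intro i
      rw [div_mul_div_comm, RCLike.star_def]
      ring
    simp only [h1]
    rw [← Finset.sum_div, hGsum]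
    by_cases hab : a = b
    · subst hab
      rw [if_pos rfl, if_pos rfl, ← Complex.ofReal_mul, Real.mul_self_sqrt (hpos _)]
      exact div_self (Complex.ofReal_ne_zero.2 (hlpos a).ne')
    · rw [if_neg hab, if_neg, zero_div]
      exact fun h => hab (e.injective (Subtype.ext h))
  · rw [orthonormal_iff_ite]
    intro a b
    simp only [PiLp.inner_apply, RCLike.inner_apply, RCLike.star_def, Complex.conj_conj]
    have := hUsum (e b) (e a)
    simp only [RCLike.star_def] at this
    rw [this]
    by_cases hab : a = b
    · simp [hab]
    · rw [if_neg hab, if_neg]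
      exact fun h => hab (e.injective (Subtype.ext h)).symm
  · intro i j
    have h1 : Ψ (i, j) = M i j := rfl
    rw [h1, hMG, Equiv.sum_comp e (fun a : {j // lam j ≠ 0} => ((√(lam a) : ℝ) : ℂ)
      * (G i a / (√(lam a) : ℂ)) * star (U j a))]
    rw [← Finset.sum_subtype (Finset.univ.filter fun a => lam a ≠ 0) (by simp)
      (fun a => ((√(lam a) : ℝ) : ℂ) * (G i a / (√(lam a) : ℂ)) * star (U j a)), Finset.sum_filter]
    refine Finset.sum_congr rfl fun a _ => ?_
    split_ifs with ha
    · rw [mul_div_cancel₀]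
      exact Complex.ofReal_ne_zero.2 (Real.sqrt_pos.2 ((hpos a).lt_of_ne' ha)).ne'
    · rw [hG0 a (not_not.1 ha), zero_mul]

theorem HasSchmidtDecomposition.rank_le {m n r : ℕ} {Ψ : EuclideanSpace ℂ (Fin m × Fin n)}
    (h : HasSchmidtDecomposition Ψ r) : (coeffMatrix Ψ).rank ≤ r := by
  obtain ⟨s, u, v, -, -, -, hΨ⟩ := h
  have : coeffMatrix Ψ = (Matrix.of fun i l => (s l : ℂ) * u l i : Matrix (Fin m) (Fin r) ℂ)
      * (Matrix.of fun l j => v l j : Matrix (Fin r) (Fin n) ℂ) := by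
    ext i j
    simp [coeffMatrix, hΨ, Matrix.mul_apply]
  rw [this]
  exact (Matrix.rank_mul_le_left _ _).trans ((Matrix.rank_le_card_width _).trans (by simp))

theorem hasSchmidtDecomposition_schmidtRank {m n : ℕ} (Ψ : EuclideanSpace ℂ (Fin m × Fin n)) :
    HasSchmidtDecomposition Ψ (schmidtRank Ψ) :=
  Nat.sInf_mem (s := {r | HasSchmidtDecomposition Ψ r}) ⟨_, hasSchmidtDecomposition_rank Ψ⟩

theorem schmidtRank_eq_rank {m n : ℕ} (Ψ : EuclideanSpace ℂ (Fin m × Fin n)) :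
    schmidtRank Ψ = (coeffMatrix Ψ).rank :=
  le_antisymm (Nat.sInf_le (hasSchmidtDecomposition_rank Ψ))
    (HasSchmidtDecomposition.rank_le (hasSchmidtDecomposition_schmidtRank Ψ))

/-- Lower semicontinuity of the rank of a linear map, pulled back along the continuous linear map
from Ψ to its coefficient operator. -/
theorem isClosed_schmidtRank_le (m n k : ℕ) :
    IsClosed {Ψ : EuclideanSpace ℂ (Fin m × Fin n) | schmidtRank Ψ ≤ k} := by
  let T : EuclideanSpace ℂ (Fin m × Fin n) →ₗ[ℂ] ((Fin n → ℂ) →L[ℂ] (Fin m → ℂ)) :=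
    { toFun := fun Ψ => LinearMap.toContinuousLinearMap (Matrix.toLin' (coeffMatrix Ψ))
      map_add' := fun x y => by
        rw [← map_add, ← map_add]; rfl
      map_smul' := fun c x => by
        rw [RingHom.id_apply, ← map_smul, ← map_smul]; rfl }
  have hT : Continuous T := T.continuous_of_finiteDimensional
  have hopen := (isOpen_setOfPred_nat_le_rank (𝕜 := ℂ) (E := Fin n → ℂ) (F := Fin m → ℂ)
    (k + 1)).preimage hT
  rw [← isOpen_compl_iff]
  convert hopen using 1
  ext Ψ
  have h1 : ((T Ψ : (Fin n → ℂ) →L[ℂ] (Fin m → ℂ)) : (Fin n → ℂ) →ₗ[ℂ] (Fin m → ℂ)).rank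
      = ((coeffMatrix Ψ).rank : Cardinal) := by
    rw [Matrix.rank, LinearMap.rank, Module.finrank_eq_rank]
    rfl
  simp only [Set.mem_compl_iff, Set.mem_ofPred_eq, not_le, Set.mem_preimage, h1, Nat.cast_le,
    schmidtRank_eq_rank]
  rfl

/-- Orthonormal families can be lengthened. -/
theorem exists_orthonormal_extension {d r k : ℕ} (hrk : r ≤ k) (hkd : k ≤ d)
    {u : Fin r → EuclideanSpace ℂ (Fin d)} (hu : Orthonormal ℂ u) :
    ∃ u' : Fin k → EuclideanSpace ℂ (Fin d), Orthonormal ℂ u' ∧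
      ∀ l, u' (Fin.castLE hrk l) = u l := by
  let w : Fin d → EuclideanSpace ℂ (Fin d) := fun i => if h : i.val < r then u ⟨i, h⟩ else 0
  have hw : Orthonormal ℂ (Set.domRestrict {i : Fin d | i.val < r} w) := by
    have : Set.domRestrict {i : Fin d | i.val < r} w
        = u ∘ fun i : {i : Fin d | i.val < r} => ⟨i.1.val, i.2⟩ := by
      ext1 i
      have hi : i.1.val < r := i.2
      simp [w, hi]
    rw [this]
    refine hu.comp _ fun i j hij => ?_
    exact Subtype.ext (Fin.ext (Fin.mk.inj_iff.1 hij))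
  obtain ⟨b, hb⟩ := hw.exists_orthonormalBasis_extension_of_card_eq (by simp)
  refine ⟨fun l => b (Fin.castLE hkd l), b.orthonormal.comp _ (Fin.castLE_injective hkd),
    fun l => ?_⟩
  have := hb (Fin.castLE hkd (Fin.castLE hrk l)) l.isLt
  simpa [w] using this

/-- Padding with zero coefficients gives exactly k terms, so that all vectors of rank at most k are
compared with arrangements of the same size. -/
theorem exists_schmidt_of_schmidtRank_le {m n k : ℕ} (hmn : m ≤ n) (hkm : k ≤ m)
    {Ψ : EuclideanSpace ℂ (Fin m × Fin n)} (h : schmidtRank Ψ ≤ k) (hΨ1 : ‖Ψ‖ = 1) :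
    ∃ (s : Fin k → ℝ) (u : Fin k → EuclideanSpace ℂ (Fin m))
      (v : Fin k → EuclideanSpace ℂ (Fin n)), (∀ l, 0 ≤ s l) ∧ ∑ l, s l ^ 2 = 1 ∧
      Orthonormal ℂ u ∧ Orthonormal ℂ v ∧ ∀ i j, Ψ (i, j) = ∑ l, (s l : ℂ) * u l i * v l j := by
  obtain ⟨s, u, v, hs, hu, hv, hΨ⟩ := hasSchmidtDecomposition_schmidtRank Ψ
  obtain ⟨u', hu', huu⟩ := exists_orthonormal_extension h hkm hu
  obtain ⟨v', hv', hvv⟩ := exists_orthonormal_extension h (hkm.trans hmn) hv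
  let s' : Fin k → ℝ := fun l => if h : l.val < schmidtRank Ψ then s ⟨l, h⟩ else 0
  have hΨ' : ∀ i j, Ψ (i, j) = ∑ l, (s' l : ℂ) * u' l i * v' l j := by
    intro i j
    rw [hΨ]
    refine Finset.sum_of_injOn (Fin.castLE h) (Fin.castLE_injective h).injOn
      (fun _ _ => Finset.mem_coe.2 (Finset.mem_univ _)) ?_ ?_
    · intro l _ hl
      have : ¬ l.val < schmidtRank Ψ := fun h' => hl ⟨⟨l, h'⟩, by simp, rfl⟩
      simp [s', this]
    · intro l _
      simp [s', huu, hvv]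
  refine ⟨s', u', v', fun l => ?_, ?_, hu', hv', hΨ'⟩
  · simp only [s']
    split_ifs
    · exact (hs _).le
    · exact le_rfl
  · have h1 := sum_kronecker_eq (1 : Matrix (Fin m) (Fin m) ℂ) (1 : Matrix (Fin n) (Fin n) ℂ)
      s' u' v' hΨ'
    have h2 : ∀ {d : ℕ} {w : Fin k → EuclideanSpace ℂ (Fin d)}, Orthonormal ℂ w →
        ∀ p, matrixElement w 1 p = if p.1 = p.2 then 1 else 0 := by
      intro d w hw p
      rw [← orthonormal_iff_ite.1 hw p.1 p.2]
      simp [matrixElement, PiLp.inner_apply, Matrix.one_apply, mul_comm]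
    simp only [h2 hu', h2 hv', Matrix.one_kronecker_one, Matrix.one_apply] at h1
    have h3 : ∑ a, ∑ b, star (Ψ a) * (if a = b then 1 else 0) * Ψ b = ((‖Ψ‖ ^ 2 : ℝ) : ℂ) := by
      rw [EuclideanSpace.norm_sq_eq]
      simp [Complex.conj_mul']
    rw [h3, hΨ1, Fintype.sum_prod_type] at h1
    have h4 : ((∑ l, s' l ^ 2 : ℝ) : ℂ) = 1 := by
      simpa [sq] using h1.symm
    exact_mod_cast h4

/-! ### Expectation values, Schmidt number and witnesses -/

section Witness

variable {m n : ℕ} {X ρ : Matrix (Fin m × Fin n) (Fin m × Fin n) ℂ}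

/-- Some pure-state decomposition realizes the Schmidt number. -/
theorem IsDensityMatrix.exists_decomposition (hρ : IsDensityMatrix ρ) :
    ∃ (N : ℕ) (p : Fin N → ℝ) (Ψ : Fin N → EuclideanSpace ℂ (Fin m × Fin n)),
      (∀ i, 0 ≤ p i) ∧ ∑ i, p i = 1 ∧ (∀ i, ‖Ψ i‖ = 1) ∧
      ρ = ∑ i, (p i : ℂ) • ketBra (Ψ i) ∧ ∀ i, schmidtRank (Ψ i) ≤ schmidtNumber ρ := by
  obtain ⟨hpsd, htr⟩ := hρ
  refine Nat.sInf_mem (s := {r | ∃ (N : ℕ) (p : Fin N → ℝ)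
    (Ψ : Fin N → EuclideanSpace ℂ (Fin m × Fin n)),
    (∀ i, 0 ≤ p i) ∧ ∑ i, p i = 1 ∧ (∀ i, ‖Ψ i‖ = 1) ∧
    ρ = ∑ i, (p i : ℂ) • ketBra (Ψ i) ∧ ∀ i, schmidtRank (Ψ i) ≤ r}) ?_
  have hH := hpsd.isHermitian
  let e : Fin (m * n) ≃ Fin m × Fin n := finProdFinEquiv.symm
  -- The spectral decomposition is one pure-state decomposition, and m bounds every Schmidt rank;
  -- hence the set defining the Schmidt number is nonempty and its infimum is attained.
  refine ⟨m, m * n, fun i => hH.eigenvalues (e i), fun i => hH.eigenvectorBasis (e i),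
    fun i => hpsd.eigenvalues_nonneg _, ?_, fun i => hH.eigenvectorBasis.orthonormal.1 _, ?_,
    fun i => ?_⟩
  · rw [Equiv.sum_comp e hH.eigenvalues]
    have := hH.trace_eq_sum_eigenvalues
    rw [htr] at this
    have h1 : ((∑ i, hH.eigenvalues i : ℝ) : ℂ) = 1 := by
      rw [Complex.ofReal_sum]
      exact this.symm
    exact_mod_cast h1
  · rw [Equiv.sum_comp e fun a => (hH.eigenvalues a : ℂ) • ketBra (hH.eigenvectorBasis a)]
    ext a b
    conv_lhs => rw [hH.spectral_theorem, Unitary.conjStarAlgAut_apply]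
    rw [Matrix.sum_apply, Matrix.mul_apply]
    refine Finset.sum_congr rfl fun c _ => ?_
    rw [Matrix.mul_diagonal]
    simp [ketBra, Matrix.star_apply]
    ring
  · rw [schmidtRank_eq_rank]
    exact (Matrix.rank_le_card_height _).trans (by simp)

theorem trace_mul_ketBra (Ψ : EuclideanSpace ℂ (Fin m × Fin n)) :
    (X * ketBra Ψ).trace = ∑ a, ∑ b, star (Ψ a) * X a b * Ψ b := by
  simp only [Matrix.trace, Matrix.diag_apply, Matrix.mul_apply, ketBra, Matrix.of_apply]
  refine Finset.sum_congr rfl fun a _ => Finset.sum_congr rfl fun b _ => ?_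
  ring

theorem trace_ketBra {Ψ : EuclideanSpace ℂ (Fin m × Fin n)} (h : ‖Ψ‖ = 1) :
    (ketBra Ψ).trace = 1 := by
  have h1 : ∑ a, ‖Ψ a‖ ^ 2 = 1 := by rw [← EuclideanSpace.norm_sq_eq, h, one_pow]
  have h2 : ((∑ a, ‖Ψ a‖ ^ 2 : ℝ) : ℂ) = 1 := by rw [h1, Complex.ofReal_one]
  rw [← h2]
  simp [Matrix.trace, ketBra, Complex.mul_conj']

theorem re_trace_sub_mul_ketBra (η : ℝ) {Ψ : EuclideanSpace ℂ (Fin m × Fin n)} (h : ‖Ψ‖ = 1) :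
    (((η : ℂ) • (1 : Matrix (Fin m × Fin n) (Fin m × Fin n) ℂ) - X) * ketBra Ψ).trace.re
      = η - expectation X Ψ := by
  rw [Matrix.sub_mul, Matrix.trace_sub, Matrix.smul_mul, Matrix.one_mul, Matrix.trace_smul,
    trace_ketBra h, trace_mul_ketBra, Complex.sub_re, expectation]
  simp

theorem re_trace_sub_mul_sum (η : ℝ) {N : ℕ} (p : Fin N → ℝ)
    {Ψ : Fin N → EuclideanSpace ℂ (Fin m × Fin n)} (h : ∀ i, ‖Ψ i‖ = 1) :
    (((η : ℂ) • (1 : Matrix (Fin m × Fin n) (Fin m × Fin n) ℂ) - X)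
      * ∑ i, (p i : ℂ) • ketBra (Ψ i)).trace.re = ∑ i, p i * (η - expectation X (Ψ i)) := by
  rw [Matrix.mul_sum, Matrix.trace_sum, Complex.re_sum]
  refine Finset.sum_congr rfl fun i _ => ?_
  rw [Matrix.mul_smul, Matrix.trace_smul, smul_eq_mul, Complex.re_ofReal_mul,
    re_trace_sub_mul_ketBra η (h i)]

theorem isDensityMatrix_ketBra {Ψ : EuclideanSpace ℂ (Fin m × Fin n)} (h : ‖Ψ‖ = 1) :
    IsDensityMatrix (ketBra Ψ) :=
  ⟨Matrix.posSemidef_vecMulVec_self_star (fun a => Ψ a), trace_ketBra h⟩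

theorem schmidtNumber_ketBra_le {k : ℕ} {Ψ : EuclideanSpace ℂ (Fin m × Fin n)} (h : ‖Ψ‖ = 1)
    (hk : schmidtRank Ψ ≤ k) : schmidtNumber (ketBra Ψ) ≤ k :=
  Nat.sInf_le ⟨1, fun _ => 1, fun _ => Ψ, by simp, by simp, by simpa using h, by simp,
    by simpa using hk⟩

theorem continuous_expectation : Continuous (expectation X) := by
  unfold expectation
  fun_prop

theorem schmidtRank_single_le_one (a : Fin m × Fin n) :
    schmidtRank (EuclideanSpace.single a (1 : ℂ)) ≤ 1 := by
  refine Nat.sInf_le ⟨fun _ => 1, fun _ => EuclideanSpace.single a.1 1,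
    fun _ => EuclideanSpace.single a.2 1, by simp, ?_, ?_, ?_⟩
  · simp
  · simp
  · intro i j
    obtain ⟨a1, a2⟩ := a
    simp only [PiLp.single_apply, Prod.mk.injEq]
    by_cases h1 : i = a1 <;> by_cases h2 : j = a2 <;> simp [h1, h2]

/-- The maximum over unit vectors of bounded Schmidt rank is attained. -/
theorem isGreatest_expectationSet (hm : 0 < m) (hn : 0 < n) {k : ℕ} (hk : 1 ≤ k) :
    IsGreatest (expectationSet X k) (optimalCoeff X (k + 1)) := by
  have hcomp : IsCompact (Metric.sphere (0 : EuclideanSpace ℂ (Fin m × Fin n)) 1 ∩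
      {Ψ | schmidtRank Ψ ≤ k}) := (isCompact_sphere _ _).inter_right (isClosed_schmidtRank_le m n k)
  have hne : (Metric.sphere (0 : EuclideanSpace ℂ (Fin m × Fin n)) 1 ∩
      {Ψ | schmidtRank Ψ ≤ k}).Nonempty :=
    ⟨EuclideanSpace.single (⟨0, hm⟩, ⟨0, hn⟩) 1, by simp, (schmidtRank_single_le_one _).trans hk⟩
  obtain ⟨Ψ, ⟨h1, h2⟩, hmax⟩ := hcomp.exists_isMaxOn hne (continuous_expectation (X := X)).continuousOn
  have hg : IsGreatest (expectationSet X k) (expectation X Ψ) := by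
    refine ⟨⟨Ψ, mem_sphere_zero_iff_norm.1 h1, h2, rfl⟩, ?_⟩
    rintro t ⟨Φ, hΦ1, hΦ2, rfl⟩
    exact hmax ⟨mem_sphere_zero_iff_norm.2 hΦ1, hΦ2⟩
  have : optimalCoeff X (k + 1) = expectation X Ψ := hg.csSup_eq
  rwa [this]

theorem expectation_le_etaBound {k : ℕ} {μ : ℕ → ℝ} (hmn : m ≤ n) (hk : 1 ≤ k) (hkm : k ≤ m)
    (hμ : IsOperatorSchmidtCoeffs X μ) {Ψ : EuclideanSpace ℂ (Fin m × Fin n)} (hΨ : ‖Ψ‖ = 1)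
    (hrank : schmidtRank Ψ ≤ k) : expectation X Ψ ≤ etaBound μ k := by
  obtain ⟨s, u, v, hs, hs1, hu, hv, hdec⟩ := exists_schmidt_of_schmidtRank_le hmn hkm hrank hΨ
  obtain ⟨e, he⟩ := exists_expectation_le_arrangementForm hmn hkm hμ hs hu hv hdec
  have hsub : Set.Icc 1 (k ^ 2) ⊆ Set.Icc 1 (min (m ^ 2) (n ^ 2)) :=
    Set.Icc_subset_Icc_right (le_min (Nat.pow_le_pow_left hkm 2)
      (Nat.pow_le_pow_left (hkm.trans hmn) 2))
  exact he.trans (arrangementForm_le_etaBound hk (hμ.1.mono hsub)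
    (fun i hi => hμ.2.1 i (hsub hi)) e s hs1)

/-- An upper bound on the expectation values of bounded Schmidt rank yields nonnegativity on the
states of bounded Schmidt number. -/
theorem re_trace_nonneg_of_expectation_le {k : ℕ} {η : ℝ}
    (h : ∀ Ψ : EuclideanSpace ℂ (Fin m × Fin n), ‖Ψ‖ = 1 → schmidtRank Ψ ≤ k →
      expectation X Ψ ≤ η) (hρ : ρ ∈ schmidtSet m n k) :
    0 ≤ (((η : ℂ) • (1 : Matrix (Fin m × Fin n) (Fin m × Fin n) ℂ) - X) * ρ).trace.re := by
  obtain ⟨hdens, hsn⟩ := hρ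
  obtain ⟨N, p, Ψ, hp, -, hΨ, hdec, hr⟩ := hdens.exists_decomposition
  rw [hdec, re_trace_sub_mul_sum η p hΨ]
  exact Finset.sum_nonneg fun i _ => mul_nonneg (hp i)
    (sub_nonneg.2 (h _ (hΨ i) ((hr i).trans hsn)))

end Witness

theorem mainTheorem2 (m n k : ℕ) (hm : 5 ≤ m) (hmn : m ≤ n) (hk : 1 ≤ k) (hkm : k ≤ m)
    (X : Matrix (Fin m × Fin n) (Fin m × Fin n) ℂ) (hX : X.IsHermitian)
    (μ : ℕ → ℝ) (hμ : IsOperatorSchmidtCoeffs X μ) :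
    IsGreatest (expectationSet X k) (optimalCoeff X (k + 1)) ∧
    optimalCoeff X (k + 1) ≤ etaBound μ k ∧
    IsSchmidtNumberWitness (k + 1)
      (((etaBound μ k : ℝ) : ℂ) • (1 : Matrix (Fin m × Fin n) (Fin m × Fin n) ℂ) - X) ∧
    (∀ ρ : Matrix (Fin m × Fin n) (Fin m × Fin n) ℂ, IsDensityMatrix ρ →
      ((((etaBound μ k : ℝ) : ℂ) • (1 : Matrix (Fin m × Fin n) (Fin m × Fin n) ℂ) - X)
        * ρ).trace.re < 0 → k + 1 ≤ schmidtNumber ρ) ∧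
    (IsDetectingSchmidtNumberWitness (k + 1)
      (((etaBound μ k : ℝ) : ℂ) • (1 : Matrix (Fin m × Fin n) (Fin m × Fin n) ℂ) - X) ↔
      etaBound μ k < optimalCoeff X (k + 2)) := by
  have hbound : ∀ Ψ : EuclideanSpace ℂ (Fin m × Fin n), ‖Ψ‖ = 1 → schmidtRank Ψ ≤ k →
      expectation X Ψ ≤ etaBound μ k := fun Ψ h1 h2 =>
    expectation_le_etaBound hmn hk hkm hμ h1 h2
  have hgreat := isGreatest_expectationSet (X := X) (by omega) (by omega) hk
  have hgreat' := isGreatest_expectationSet (X := X) (k := k + 1) (by omega) (by omega) (by omega)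
  have hwit : IsSchmidtNumberWitness (k + 1)
      (((etaBound μ k : ℝ) : ℂ) • (1 : Matrix (Fin m × Fin n) (Fin m × Fin n) ℂ) - X) := by
    refine ⟨?_, fun σ hσ => re_trace_nonneg_of_expectation_le hbound hσ⟩
    refine Matrix.IsHermitian.sub ?_ hX
    rw [Matrix.IsHermitian, Matrix.conjTranspose_smul, Matrix.conjTranspose_one,
      RCLike.star_def, Complex.conj_ofReal]
  refine ⟨hgreat, ?_, hwit, ?_, ?_, ?_⟩
  · obtain ⟨Ψ, h1, h2, h3⟩ := hgreat.1
    rw [h3]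
    exact hbound Ψ h1 h2
  · intro ρ hρ hneg
    by_contra hcon
    exact absurd (hwit.2 ρ ⟨hρ, by omega⟩) (not_le.2 hneg)
  · rintro ⟨-, ρ, hρ, hneg⟩
    by_contra hcon
    -- If η were at least λ_{k+2}, the operator would be nonnegative on all of S_{k+1} and would
    -- detect nothing there.
    refine absurd (re_trace_nonneg_of_expectation_le (fun Ψ h1 h2 => ?_) hρ) (not_le.2 hneg)
    exact (hgreat'.2 ⟨Ψ, h1, h2, rfl⟩).trans (not_lt.1 hcon)
  · intro hlt
    -- The detected state is the pure state attaining λ_{k+2}; its trace with the witness is η -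
    -- λ_{k+2}.
    obtain ⟨Ψ, h1, h2, h3⟩ := hgreat'.1
    refine ⟨hwit, ketBra Ψ, ⟨isDensityMatrix_ketBra h1, schmidtNumber_ketBra_le h1 h2⟩, ?_⟩
    rw [re_trace_sub_mul_ketBra _ h1, ← h3]
    exact sub_neg.2 hlt
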